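/- Let $\Omega=\{(x,y,z)\in\mathbb R^3 : x^2+y^2\le 1/16,\ z\le -1\}$, and write $(r,\phi,z)$ for cylindrical coordinates. For each point of $\Omega$ let $f=f(r,\phi,z)$ be the unique solution $f\ge 1$ of $$f+z-\frac1f\ln\Big(\cosh\big(f r\sin(f-\phi)\big)\Big)-\frac{r^2}{1+f}=0 .$$ For a set-valued map $F:\mathbb R^n\to 2^{\mathbb R^n}$ and a right-continuous $U:\mathbb R\to\mathbb R^n$, a perturbed trajectory of $F$ with perturbation $U$ is a measurable, locally integrable function $\tilde x$ for which there is a measurable, locally integrable $\xi$ with $\xi(t)\in F(\tilde x(t))$ and $\tilde x(t)=\tilde x(0)+\int_0^t\xi(\tau)\,d\tau+U(t)$ for all $t\ge 0$; it is called unperturbed if $U\equiv 0$. The system $F$ has bounded sensitivity if there is a constant $C$ such that, for every unperturbed trajectory $x$ and every perturbed trajectory $\tilde x$ (with perturbation $U$) satisfying $\tilde x(0)=x(0)$, $$\|\tilde x(t)-x(t)\|_2\le C\sup_{0\le\tau\le t}\|U(\tau)\|_2\qquad\text{for all } t\ge 0 ;$$ otherwise it has unbounded sensitivity. A function on $\mathbb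 R^n$ is piecewise linear if $\mathbb R^n$ is covered by a locally finite family of closed convex polyhedra on each of which the function is affine. **Theorem.** The function $f$ is well defined on $\Omega$, and there exist a strictly increasing, twice continuously differentiable $h:\mathbb R\to\mathbb R$ such that $\Phi=h\circ f$ is strictly convex on $\Omega$, and a piecewise linear convex function $\Psi:\mathbb R^3\to\mathbb R$ such that 1. $\Psi$ has infinitely many pieces, i.e. it is not of the form $\max_{i}(-\mu_i^Tx+b_i)$ with $i$ ranging over a finite set; 2. $\Psi$ approximates $\Phi$ increasingly well as $z\to-\infty$: $\sup\{|\Psi(p)-\Phi(p)| : p\in\Omega,\ z(p)\le\zeta\}\to 0$ as $\zeta\to-\infty$; 3. the subgradient system $F(x)=-\partial\Psi(x)$ has unbounded sensitivity. In particular, the finiteness of the number of pieces cannot be dropped in the theorem that $-\partial\Psi$ has bounded sensitivity whenever $\Psi(x)=\max_i(-\mu_i^Tx+b_i)$ is a maximum over a finite index set. -/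

import Mathlib

open MeasureTheory
open scoped NNReal ENNReal RealInnerProductSpace

/-- Three-dimensional Euclidean space; `p 0`, `p 1`, `p 2` are the Cartesian coordinates
`x`, `y`, `z` of `p`. -/
abbrev E3 : Type := EuclideanSpace ℝ (Fin 3)

section Dynamics

variable {E : Type*} [NormedAddCommGroup E] [InnerProductSpace ℝ E]

/-- The (convex-analytic) subdifferential of `Φ` at `x`. -/
def subdifferential (Φ : E → ℝ) (x : E) : Set E :=
  {g | ∀ y, Φ x + ⟪g, y - x⟫ ≤ Φ y}

/-- The subgradient dynamical system `F(x) = -∂Φ(x)`. -/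
def subgradientField (Φ : E → ℝ) (x : E) : Set E :=
  {v | -v ∈ subdifferential Φ x}

variable [MeasurableSpace E]

/-- `x` is a trajectory of the differential inclusion `ẋ ∈ F(x)` under the cumulative
perturbation `U`: for some drift `ξ` with `ξ(t) ∈ F(x(t))`, one has
`x(t) = x(0) + ∫₀ᵗ ξ + U(t)` for all `t ≥ 0` (in particular `U(0) = 0`).
Values at negative times are irrelevant. -/
def IsPerturbedTrajectory (F : E → Set E) (U x : ℝ → E) : Prop :=
  (∀ t, ContinuousWithinAt U (Set.Ici t) t) ∧
  Measurable x ∧ (∀ t, 0 ≤ t → IntervalIntegrable x volume 0 t) ∧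
  ∃ ξ : ℝ → E, Measurable ξ ∧ (∀ t, 0 ≤ t → IntervalIntegrable ξ volume 0 t) ∧
    ∀ t, 0 ≤ t → ξ t ∈ F (x t) ∧ x t = x 0 + (∫ τ in (0 : ℝ)..t, ξ τ) + U t

/-- A trajectory with identically zero perturbation. -/
def IsUnperturbedTrajectory (F : E → Set E) (x : ℝ → E) : Prop :=
  IsPerturbedTrajectory F (fun _ => 0) x

/-- Bounded sensitivity: a constant `C` bounds the distance at every time `t ≥ 0` of a perturbed
and an unperturbed trajectory with the same initial point by `C` times the supremum (possibly
infinite) of `‖U(τ)‖` over `0 ≤ τ ≤ t`. -/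
def HasBoundedSensitivity (F : E → Set E) : Prop :=
  ∃ C : ℝ≥0, ∀ x U y : ℝ → E,
    IsUnperturbedTrajectory F x → IsPerturbedTrajectory F U y → y 0 = x 0 →
      ∀ t, 0 ≤ t → edist (y t) (x t) ≤ C * ⨆ τ ∈ Set.Icc 0 t, ‖U τ‖ₑ

end Dynamics

section PiecewiseLinear

variable {E : Type*} [NormedAddCommGroup E] [InnerProductSpace ℝ E]

/-- A closed convex polyhedron: a finite intersection of closed half-spaces. -/
def IsPolyhedron (P : Set E) : Prop :=
  ∃ (m : ℕ) (g : Fin m → E) (c : Fin m → ℝ), P = {x | ∀ i, ⟪g i, x⟫ ≤ c i}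

/-- `Ψ` is piecewise linear: the space is covered by a locally finite family of closed convex
polyhedra on each of which `Ψ` is affine. -/
def IsPiecewiseLinear (Ψ : E → ℝ) : Prop :=
  ∃ (ι : Type) (P : ι → Set E), LocallyFinite P ∧ (⋃ i, P i) = Set.univ ∧
    ∀ i, IsPolyhedron (P i) ∧ ∃ (μ : E) (b : ℝ), ∀ x ∈ P i, Ψ x = -⟪μ, x⟫ + b

/-- `Ψ` is a piecewise linear convex function with finitely many pieces,
`Ψ(x) = max_i (-μ_iᵀ x + b_i)` with `i` in a finite set. Its subgradient field is then an FPCS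
system. -/
def IsFinitelyPiecewiseLinearConvex (Ψ : E → ℝ) : Prop :=
  ∃ (m : ℕ) (μ : Fin m → E) (b : Fin m → ℝ),
    ∀ x, IsGreatest (Set.range fun i => -⟪μ i, x⟫ + b i) (Ψ x)

end PiecewiseLinear

/-- The half-cylinder `r ≤ 1/4`, `z ≤ -1`. -/
def halfCylinder : Set E3 :=
  {p | p 0 ^ 2 + p 1 ^ 2 ≤ (1 / 4) ^ 2 ∧ p 2 ≤ -1}

/-- The equation `a + z - (1/a) ln cosh (a r sin(a - φ)) - r² / (1 + a) = 0` in cylindrical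
coordinates, written in Cartesian coordinates by `r sin(a - φ) = x sin a - y cos a`. -/
def BookEquation (p : E3) (a : ℝ) : Prop :=
  a + p 2 - 1 / a * Real.log (Real.cosh (a * (p 0 * Real.sin a - p 1 * Real.cos a)))
    - (p 0 ^ 2 + p 1 ^ 2) / (1 + a) = 0

/-- On the half-cylinder, `f` is the unique solution `a = f(p) ≥ 1` of the book equation. -/
def IsBookFunction (f : E3 → ℝ) : Prop :=
  ∀ p ∈ halfCylinder, 1 ≤ f p ∧ ∀ a : ℝ, 1 ≤ a → (BookEquation p a ↔ a = f p)

/-- `Ψ` approximates `Φ` on the half-cylinder with an error that tends to zero, uniformly in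
the other coordinates, as `z → -∞`. -/
def ApproximatesDownward (Ψ Φ : E3 → ℝ) : Prop :=
  ∀ ε > 0, ∃ ζ : ℝ, ∀ p ∈ halfCylinder, p 2 ≤ ζ → |Ψ p - Φ p| ≤ ε

/-! The level set `f = a` is an open book: the graph of `-a + (1/a) log cosh (a s) + r²/(1+a)`,
where `s` is the signed distance to the line through the axis in direction `a`. It is close to `-a +
|s|`, creased along a spine whose direction turns with the level. The flow of `-∇(h ∘ f)` climbs
while sliding towards the spine.

Convexity: at fixed `a` the equation is concave in the point (`book_le_tangent`). Its derivative in
`a` lies in `[1/2, 3/2]` (`bookDeriv_mem`) and is Lipschitz with constant `O(a)`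
(`abs_bookDeriv_sub_le`). A doubly exponential `h` absorbs the remaining second-order error, of
order `a³` (`height_tangent_lt`).

`Ψ` is the supremum of the tangents of `h ∘ f` at a set of points with finitely many above each
height. Finite nets of slabs give the approximation. Tangents at deep points are very negative on a
given ball, hence local finiteness; their gradients are unbounded, hence infinitely many pieces. At
a tangent point the gradient of `h ∘ f` is a subgradient of `Ψ`, so any drift needed below is
obtained by adding its point to the set.

Sensitivity: the set is invariant under a half turn, so an unperturbed trajectory can stay on the
axis. A perturbation of size `O(β)` allows the drift to be taken from a level shifted by `β`, whose
spine is turned by `β`. With the sense of the shift chosen by the side of the spine, the drift on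
either side has an outward component of about `β` along the spine, while its component across keeps
the path near it (`Steerable.steer_bounds`). Climbing a height `L` yields a displacement of order `β
L`; with `β L` fixed and `L` large, its ratio to the perturbation is unbounded
(`exists_control_sequence`). `exists_jumping_trajectory` turns this path into a perturbed
trajectory. -/

/-! ### Locally finite maxima of affine functions. -/

section MaxAffine

variable {E : Type*} [NormedAddCommGroup E] [InnerProductSpace ℝ E] {ι : Type*}

/-- The supremum of the affine functions `p ↦ ⟪g j, p⟫ + b j`. -/
noncomputable def maxAffine (g : ι → E) (b : ι → ℝ) (p : E) : ℝ := ⨆ j, (⟪g j, p⟫ + b j)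

/-- On every ball, only finitely many of the affine functions exceed a given bound. -/
def LocallyFewAffine (g : ι → E) (b : ι → ℝ) : Prop :=
  ∀ R M : ℝ, {j | ∃ p : E, ‖p‖ ≤ R ∧ M ≤ ⟪g j, p⟫ + b j}.Finite

variable {g : ι → E} {b : ι → ℝ}

/-- Only finitely many members reach the value of a fixed one at `p`, so the supremum is attained.
-/
lemma LocallyFewAffine.exists_isMax [Nonempty ι] (h : LocallyFewAffine g b) (p : E) :
    ∃ j, ∀ i, ⟪g i, p⟫ + b i ≤ ⟪g j, p⟫ + b j := by
  obtain ⟨j₀⟩ := ‹Nonempty ι›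
  have hf : {j | ⟪g j₀, p⟫ + b j₀ ≤ ⟪g j, p⟫ + b j}.Finite :=
    (h ‖p‖ (⟪g j₀, p⟫ + b j₀)).subset fun j hj => ⟨p, le_rfl, hj⟩
  obtain ⟨j, hj, hmax⟩ := Set.exists_max_image _ (fun j => ⟪g j, p⟫ + b j) hf
    ⟨j₀, le_refl (⟪g j₀, p⟫ + b j₀)⟩
  refine ⟨j, fun i => ?_⟩
  rcases le_total (⟪g j₀, p⟫ + b j₀) (⟪g i, p⟫ + b i) with hi | hi
  · exact hmax i hi
  · exact hi.trans hj

lemma LocallyFewAffine.le_maxAffine [Nonempty ι] (h : LocallyFewAffine g b) (p : E) (i : ι) :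
    ⟪g i, p⟫ + b i ≤ maxAffine g b p := by
  obtain ⟨j, hj⟩ := h.exists_isMax p
  exact le_ciSup (f := fun j => ⟪g j, p⟫ + b j) ⟨_, by rintro _ ⟨i, rfl⟩; exact hj i⟩ i

lemma maxAffine_le [Nonempty ι] {p : E} {c : ℝ} (h : ∀ i, ⟪g i, p⟫ + b i ≤ c) :
    maxAffine g b p ≤ c := ciSup_le h

lemma LocallyFewAffine.exists_eq [Nonempty ι] (h : LocallyFewAffine g b) (p : E) :
    ∃ j, maxAffine g b p = ⟪g j, p⟫ + b j := by
  obtain ⟨j, hj⟩ := h.exists_isMax p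
  exact ⟨j, le_antisymm (maxAffine_le hj) (h.le_maxAffine p j)⟩

lemma LocallyFewAffine.mem_subdifferential [Nonempty ι] (h : LocallyFewAffine g b) {p : E} {j : ι}
    (hj : maxAffine g b p = ⟪g j, p⟫ + b j) : g j ∈ subdifferential (maxAffine g b) p := by
  intro y
  have := h.le_maxAffine y j
  rw [hj, inner_sub_right]
  linarith

lemma LocallyFewAffine.convexOn [Nonempty ι] (h : LocallyFewAffine g b) :
    ConvexOn ℝ Set.univ (maxAffine g b) := by
  refine ⟨convex_univ, fun x _ y _ s t hs ht hst => maxAffine_le fun i => ?_⟩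
  have hx := mul_le_mul_of_nonneg_left (h.le_maxAffine x i) hs
  have hy := mul_le_mul_of_nonneg_left (h.le_maxAffine y i) ht
  rw [inner_add_right, inner_smul_right, inner_smul_right, smul_eq_mul, smul_eq_mul]
  have : b i = s * b i + t * b i := by rw [← add_mul, hst, one_mul]
  linarith

lemma isPolyhedron_of_fintype {κ : Type*} [Fintype κ] (g : κ → E) (c : κ → ℝ) :
    IsPolyhedron {x | ∀ i, ⟪g i, x⟫ ≤ c i} := by
  refine ⟨Fintype.card κ, g ∘ (Fintype.equivFin κ).symm, c ∘ (Fintype.equivFin κ).symm, ?_⟩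
  ext x
  exact ((Fintype.equivFin κ).symm.forall_congr_right (q := fun i => ⟪g i, x⟫ ≤ c i)).symm

/-- The closed unit cube with lower corner `n`. -/
def unitCube (n : Fin 3 → ℤ) : Set E3 := {p | ∀ i, (n i : ℝ) ≤ p i ∧ p i ≤ n i + 1}

lemma norm_le_of_coord_le {p : E3} {c : ℝ} (hc : ∀ i, |p i| ≤ c) : ‖p‖ ≤ 2 * c := by
  have h0 : 0 ≤ c := (abs_nonneg _).trans (hc 0)
  rw [EuclideanSpace.norm_eq]
  apply Real.sqrt_le_iff.2 ⟨by positivity, ?_⟩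
  simp only [Fin.sum_univ_three, Real.norm_eq_abs, sq_abs]
  have h := fun i => sq_le_sq' (abs_le.1 (hc i)).1 (abs_le.1 (hc i)).2
  nlinarith [h 0, h 1, h 2]

lemma unitCube_bounded (n : Fin 3 → ℤ) : ∃ R, ∀ p ∈ unitCube n, ‖p‖ ≤ R := by
  refine ⟨2 * (|(n 0 : ℝ)| + |(n 1 : ℝ)| + |(n 2 : ℝ)| + 1), fun p hp => norm_le_of_coord_le
    fun i => ?_⟩
  have h : |p i| ≤ |(n i : ℝ)| + 1 := by
    have := hp i
    rw [abs_le]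
    constructor <;> linarith [neg_abs_le (n i : ℝ), le_abs_self (n i : ℝ)]
  have h0 := abs_nonneg (n 0 : ℝ)
  have h1 := abs_nonneg (n 1 : ℝ)
  have h2 := abs_nonneg (n 2 : ℝ)
  fin_cases i <;> simp only [Fin.zero_eta, Fin.mk_one, Fin.reduceFinMk] at h ⊢ <;> linarith

lemma finite_unitCube_meets_ball (R : ℝ) : {n | ∃ p ∈ unitCube n, ‖p‖ ≤ R}.Finite := by
  refine (Set.finite_Icc (fun _ : Fin 3 => ⌊-R - 1⌋) (fun _ => ⌈R⌉)).subset ?_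
  rintro n ⟨p, hp, hR⟩
  have h : ∀ i, |p i| ≤ R := fun i => (PiLp.norm_apply_le p i).trans hR
  constructor <;> intro i
  · have := (hp i).2
    have := (abs_le.1 (h i)).1
    have h3 : (⌊-R - 1⌋ : ℝ) ≤ n i := (Int.floor_le _).trans (by linarith)
    exact_mod_cast h3
  · have := (hp i).1
    have := (abs_le.1 (h i)).2
    have h3 : (n i : ℝ) ≤ ⌈R⌉ := le_trans (by linarith) (Int.le_ceil _)
    exact_mod_cast h3

lemma inner_e3 (u v : E3) : ⟪u, v⟫ = u 0 * v 0 + u 1 * v 1 + u 2 * v 2 := by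
  rw [PiLp.inner_apply, Fin.sum_univ_three]
  simp [mul_comm]

/-- The maximum of a locally finite family of affine functions on three-space is piecewise
linear: its pieces are the cells of the family, cut by the integer grid. -/
lemma LocallyFewAffine.isPiecewiseLinear {ι : Type} {g : ι → E3} {b : ι → ℝ} [Nonempty ι]
    (h : LocallyFewAffine g b) : IsPiecewiseLinear (maxAffine g b) := by
  refine ⟨(Fin 3 → ℤ) × ι,
    fun k => {p | p ∈ unitCube k.1 ∧ maxAffine g b p = ⟪g k.2, p⟫ + b k.2}, ?_, ?_, ?_⟩
  · intro x
    obtain ⟨j₀⟩ := ‹Nonempty ι›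
    refine ⟨Metric.closedBall x 1, Metric.closedBall_mem_nhds x one_pos, ?_⟩
    set R := ‖x‖ + 1
    -- A lower bound of the member `j₀`, hence of the maximum, on the ball; active members must
    -- reach it somewhere.
    set M := -(‖g j₀‖ * R) + b j₀
    refine ((finite_unitCube_meets_ball R).prod (h R M)).subset ?_
    rintro ⟨n, j⟩ ⟨p, ⟨hp1, hp2⟩, hp3⟩
    have hpR : ‖p‖ ≤ R := by
      have := norm_le_norm_add_norm_sub x p
      rw [← dist_eq_norm, dist_comm] at this
      exact this.trans (add_le_add le_rfl hp3)
    refine ⟨⟨p, hp1, hpR⟩, p, hpR, ?_⟩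
    have h1 := h.le_maxAffine p j₀
    have h2 := neg_le_of_abs_le (abs_real_inner_le_norm (g j₀) p)
    have h3 := mul_le_mul_of_nonneg_left hpR (norm_nonneg (g j₀))
    simp only at hp2 ⊢
    linarith
  · refine Set.eq_univ_of_forall fun p => Set.mem_iUnion.2 ?_
    obtain ⟨j, hj⟩ := h.exists_eq p
    exact ⟨(fun i => ⌊p i⌋, j), fun i => ⟨Int.floor_le _, (Int.lt_floor_add_one _).le⟩, hj⟩
  · rintro ⟨n, j⟩
    refine ⟨?_, -g j, b j, fun x hx => by rw [hx.2, inner_neg_left, neg_neg]⟩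
    obtain ⟨R, hR⟩ := unitCube_bounded n
    obtain ⟨j₀⟩ := ‹Nonempty ι›
    set M := -(‖g j₀‖ * R) + b j₀
    have := (h R M).fintype
    set A := {j | ∃ p : E3, ‖p‖ ≤ R ∧ M ≤ ⟪g j, p⟫ + b j}
    -- Six faces of the cube, and comparisons with the finite set `A` only: no other member is
    -- active in the cube. An uncut cell might need infinitely many inequalities.
    convert isPolyhedron_of_fintype (κ := (Fin 3 ⊕ Fin 3) ⊕ A)
      (Sum.elim (Sum.elim (fun i => -EuclideanSpace.single i (1 : ℝ))
        (fun i => EuclideanSpace.single i (1 : ℝ))) (fun i => g i - g j))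
      (Sum.elim (Sum.elim (fun i => -(n i : ℝ)) (fun i => (n i : ℝ) + 1)) (fun i => b j - b i))
      using 1
    ext p
    simp only [Set.mem_ofPred_eq, Sum.forall, Sum.elim_inl, Sum.elim_inr, inner_neg_left,
      EuclideanSpace.inner_single_left, map_one, one_mul, inner_sub_left, neg_le_neg_iff]
    constructor
    · rintro ⟨hp1, hp2⟩
      refine ⟨⟨fun i => (hp1 i).1, fun i => (hp1 i).2⟩, fun i => ?_⟩
      have := h.le_maxAffine p i
      linarith
    · rintro ⟨⟨hp1, hp2⟩, hp3⟩
      have hp : p ∈ unitCube n := fun i => ⟨hp1 i, hp2 i⟩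
      refine ⟨hp, le_antisymm ?_ (h.le_maxAffine p j)⟩
      obtain ⟨i, hi⟩ := h.exists_eq p
      have hiA : i ∈ A := by
        refine ⟨p, hR p hp, ?_⟩
        have h1 := h.le_maxAffine p j₀
        have h2 := neg_le_of_abs_le (abs_real_inner_le_norm (g j₀) p)
        have h3 := mul_le_mul_of_nonneg_left (hR p hp) (norm_nonneg (g j₀))
        linarith
      have := hp3 ⟨i, hiA⟩
      simp only at this
      linarith

/-- A finite maximum of affine functions has bounded subgradients. -/
lemma IsFinitelyPiecewiseLinearConvex.exists_norm_le {Ψ : E → ℝ}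
    (h : IsFinitelyPiecewiseLinearConvex Ψ) :
    ∃ C : ℝ, ∀ p, ∀ v ∈ subdifferential Ψ p, ‖v‖ ≤ C := by
  obtain ⟨m, μ, b, hΨ⟩ := h
  refine ⟨∑ i, ‖μ i‖, fun p v hv => ?_⟩
  -- The subgradient inequality is tested in its own direction: from `p` to `p + v`, `Ψ` grows by at
  -- least `‖v‖²` and by at most `‖μ i‖ ‖v‖`.
  obtain ⟨i, hi⟩ := (hΨ (p + v)).1
  have h1 : -⟪μ i, p⟫ + b i ≤ Ψ p := (hΨ p).2 ⟨i, rfl⟩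
  have h2 := hv (p + v)
  simp only at hi
  rw [← hi, add_sub_cancel_left, inner_add_right, real_inner_self_eq_norm_sq] at h2
  have h3 := neg_le_of_abs_le (abs_real_inner_le_norm (μ i) v)
  have h4 : ‖μ i‖ ≤ ∑ i, ‖μ i‖ :=
    Finset.single_le_sum (f := fun i => ‖μ i‖) (fun _ _ => norm_nonneg _) (Finset.mem_univ i)
  refine le_trans ?_ h4
  by_contra hcon
  push Not at hcon
  nlinarith [norm_nonneg v, norm_nonneg (μ i)]

end MaxAffine

/-! ### Gluing trajectories in time. -/

section Concatenation

variable {α : Type*}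

/-- The function equal to `u` before time `d`, and to `v` started at time `d` afterwards. -/
noncomputable def switchAt (d : ℝ) (u v : ℝ → α) (t : ℝ) : α := if t < d then u t else v (t - d)

section

variable {d : ℝ} {u v : ℝ → α}

lemma switchAt_of_lt {t : ℝ} (h : t < d) : switchAt d u v t = u t := if_pos h

lemma switchAt_of_le {t : ℝ} (h : d ≤ t) : switchAt d u v t = v (t - d) := if_neg (not_lt.2 h)

lemma switchAt_measurable [MeasurableSpace α] (hu : Measurable u) (hv : Measurable v) :
    Measurable (switchAt d u v) :=
  Measurable.ite measurableSet_Iio hu (hv.comp (measurable_id.sub_const d))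

end

section

variable {E : Type*} [NormedAddCommGroup E] {d : ℝ} {u v : ℝ → E}

lemma switchAt_rightContinuous (hu : Continuous u)
    (hv : ∀ t, ContinuousWithinAt v (Set.Ici t) t) (t : ℝ) :
    ContinuousWithinAt (switchAt d u v) (Set.Ici t) t := by
  rcases lt_or_ge t d with h | h
  · refine hu.continuousWithinAt.congr_of_eventuallyEq ?_ (switchAt_of_lt h)
    filter_upwards [mem_nhdsWithin_of_mem_nhds (Iio_mem_nhds h)] with s hs
    exact switchAt_of_lt hs
  · have h1 : ContinuousWithinAt (fun s => v (s - d)) (Set.Ici t) t :=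
      ContinuousWithinAt.comp (t := Set.Ici (t - d)) (f := fun s => s - d) (hv (t - d))
        (by fun_prop) (fun s hs => sub_le_sub_right hs d)
    exact h1.congr (fun s hs => switchAt_of_le (h.trans hs)) (switchAt_of_le h)

lemma switchAt_intervalIntegrable (hd : 0 ≤ d) (hu : Continuous u)
    (hv : ∀ t, 0 ≤ t → IntervalIntegrable v volume 0 t) {t : ℝ} (ht : 0 ≤ t) :
    IntervalIntegrable (switchAt d u v) volume 0 t := by
  rcases le_total t d with h | h
  · refine (hu.intervalIntegrable 0 t).congr_uIoo fun s hs => (switchAt_of_lt ?_).symm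
    rw [Set.uIoo_of_le ht] at hs
    exact hs.2.trans_le h
  · have h1 : IntervalIntegrable (switchAt d u v) volume 0 d :=
      (hu.intervalIntegrable 0 d).congr_uIoo fun s hs => (switchAt_of_lt (by
        rw [Set.uIoo_of_le hd] at hs; exact hs.2)).symm
    have h2 := (hv (t - d) (by linarith)).comp_sub_right d
    rw [zero_add, sub_add_cancel] at h2
    refine h1.trans (h2.congr_uIoo fun s hs => (switchAt_of_le ?_).symm)
    rw [Set.uIoo_of_le h] at hs
    exact hs.1.le

lemma integral_switchAt [NormedSpace ℝ E] (hd : 0 ≤ d) (hu : Continuous u)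
    (hv : ∀ t, 0 ≤ t → IntervalIntegrable v volume 0 t) {t : ℝ} (ht : d ≤ t) :
    ∫ τ in (0 : ℝ)..t, switchAt d u v τ
      = (∫ τ in (0 : ℝ)..d, u τ) + ∫ τ in (0 : ℝ)..(t - d), v τ := by
  have h1 := switchAt_intervalIntegrable hd hu hv hd
  have h2 := switchAt_intervalIntegrable hd hu hv (hd.trans ht)
  rw [← intervalIntegral.integral_add_adjacent_intervals h1 (h1.symm.trans h2)]
  congr 1
  · exact intervalIntegral.integral_congr_Ioo_of_le hd fun s hs => switchAt_of_lt hs.2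
  · rw [intervalIntegral.integral_congr_Ioo_of_le (g := fun s => v (s - d)) ht
      fun s hs => switchAt_of_le hs.1.le, intervalIntegral.integral_comp_sub_right, sub_self]

end

variable {E : Type*} [NormedAddCommGroup E] [InnerProductSpace ℝ E] {d : ℝ}

variable [CompleteSpace E] [MeasurableSpace E] [BorelSpace E] {F : E → Set E}

/-- A leg of uniform motion, with constant drift, put before a perturbed trajectory. -/
lemma IsPerturbedTrajectory.prepend {U y : ℝ → E} (h : IsPerturbedTrajectory F U y) (p v v' : E)
    (hd : 0 < d) (hv : ∀ t ∈ Set.Ico 0 d, v ∈ F (p + t • v')) :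
    IsPerturbedTrajectory F
      (switchAt d (fun t => t • (v' - v)) (fun t => U t + (y 0 - (p + d • v))))
      (switchAt d (fun t => p + t • v') y) := by
  obtain ⟨hU, hy, hyi, ξ, hξ, hξi, hsol⟩ := h
  have hc : Continuous fun t : ℝ => p + t • v' := by fun_prop
  refine ⟨switchAt_rightContinuous (by fun_prop) fun t => (hU t).add continuousWithinAt_const,
    switchAt_measurable hc.measurable hy,
    fun t ht => switchAt_intervalIntegrable hd.le hc hyi ht,
    switchAt d (fun _ => v) ξ, switchAt_measurable measurable_const hξ,
    fun t ht => switchAt_intervalIntegrable hd.le continuous_const hξi ht, fun t ht => ?_⟩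
  rw [switchAt_of_lt hd, zero_smul, add_zero]
  rcases lt_or_ge t d with h | h
  · rw [switchAt_of_lt h, switchAt_of_lt h, switchAt_of_lt h]
    refine ⟨hv t ⟨ht, h⟩, ?_⟩
    rw [intervalIntegral.integral_congr_Ioo_of_le (g := fun _ => v) ht
      fun s hs => switchAt_of_lt (hs.2.trans h), intervalIntegral.integral_const, sub_zero, smul_sub]
    abel
  · rw [switchAt_of_le h, switchAt_of_le h, switchAt_of_le h]
    obtain ⟨h1, h2⟩ := hsol (t - d) (by linarith)
    refine ⟨h1, ?_⟩
    rw [integral_switchAt hd.le continuous_const hξi h, intervalIntegral.integral_const, sub_zero,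
      h2]
    abel

/-- Uniform motion with constant drift, for ever. -/
lemma isPerturbedTrajectory_line (p v v' : E) (hv : ∀ t : ℝ, 0 ≤ t → v ∈ F (p + t • v')) :
    IsPerturbedTrajectory F (fun t => t • (v' - v)) (fun t => p + t • v') := by
  have hc : Continuous fun t : ℝ => p + t • v' := by fun_prop
  refine ⟨fun t => by fun_prop, hc.measurable, fun t _ => hc.intervalIntegrable 0 t,
    fun _ => v, measurable_const, fun t _ => continuous_const.intervalIntegrable 0 t,
    fun t ht => ⟨hv t ht, ?_⟩⟩
  beta_reduce
  rw [intervalIntegral.integral_const, sub_zero, smul_sub, zero_smul, add_zero]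
  abel

/-- A leg of uniform motion put before an unperturbed trajectory. -/
lemma IsUnperturbedTrajectory.prepend {y : ℝ → E} (h : IsUnperturbedTrajectory F y) (p v : E)
    (hd : 0 < d) (hv : ∀ t ∈ Set.Ico 0 d, v ∈ F (p + t • v)) (hy : y 0 = p + d • v) :
    IsUnperturbedTrajectory F (switchAt d (fun t => p + t • v) y) := by
  have := IsPerturbedTrajectory.prepend h p v v hd hv
  unfold IsUnperturbedTrajectory
  convert this using 1
  funext t
  rw [hy, sub_self, sub_self, add_zero]
  simp [switchAt]

/-- A piecewise constant perturbed trajectory that jumps through `p 0, …, p K`: the polygon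
`w 0, …, w K` integrates the drift, and the perturbation is the difference of the two. -/
lemma exists_jumping_trajectory {ε : ℝ} (K : ℕ) :
    ∀ (p v w : ℕ → E) (d : ℕ → ℝ), (∀ k < K, 0 < d k) → (∀ k ≤ K, v k ∈ F (p k)) →
    (∀ k < K, w (k + 1) = w k + d k • v k) → (∀ k ≤ K, ‖p k - w k‖ ≤ ε) →
    (∀ k < K, ‖p k - w (k + 1)‖ ≤ ε) →
    ∃ (y U : ℝ → E) (T : ℝ), 0 ≤ T ∧ IsPerturbedTrajectory F U y ∧ y 0 = p 0 ∧ y T = p K ∧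
      ∀ t ∈ Set.Icc 0 T, ‖U t + (p 0 - w 0)‖ ≤ ε := by
  induction K with
  | zero =>
    intro p v w d _ hv _ hpw _
    -- The path rests at its last point for ever; the perturbation may then grow, but only times up
    -- to `T` count.
    refine ⟨_, _, 0, le_rfl, isPerturbedTrajectory_line (p 0) (v 0) 0 fun t _ => ?_, by simp,
      by simp, ?_⟩
    · simpa using hv 0 le_rfl
    · rintro t ⟨h0, h1⟩
      rw [le_antisymm h1 h0, zero_smul, zero_add]
      exact hpw 0 le_rfl
  | succ K ih =>
    intro p v w d hd hv hw hpw hpw'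
    obtain ⟨y, U, T, hT, hy, hy0, hyT, hU⟩ := ih (fun k => p (k + 1)) (fun k => v (k + 1))
      (fun k => w (k + 1)) (fun k => d (k + 1)) (fun k hk => hd _ (by omega))
      (fun k hk => hv _ (by omega)) (fun k hk => hw _ (by omega)) (fun k hk => hpw _ (by omega))
      (fun k hk => hpw' _ (by omega))
    have hd0 := hd 0 (by omega)
    have hw0 := hw 0 (by omega)
    rw [zero_add] at *
    -- Velocity `0` with drift `v 0`: the path waits at `p 0` while the perturbation cancels the
    -- drift.
    refine ⟨_, _, d 0 + T, by positivity, hy.prepend (p 0) (v 0) 0 hd0 fun t _ => ?_, ?_, ?_, ?_⟩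
    · simpa using hv 0 (by omega)
    · rw [switchAt_of_lt hd0]; simp
    · rw [switchAt_of_le (by linarith), add_sub_cancel_left, hyT]
    · rintro t ⟨h0, h1⟩
      rcases lt_or_ge t (d 0) with h | h
      · rw [switchAt_of_lt h]
        have e : t • (0 - v 0) + (p 0 - w 0) = (1 - t / d 0) • (p 0 - w 0)
            + (t / d 0) • (p 0 - w 1) := by
          rw [hw0]
          have : t • v 0 = (t / d 0) • d 0 • v 0 := by
            rw [smul_smul, div_mul_cancel₀ _ hd0.ne']
          rw [zero_sub, smul_neg, this]
          module
        have ht1 : t / d 0 ≤ 1 := (div_le_one hd0).2 h.le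
        have ht0 : 0 ≤ t / d 0 := by positivity
        rw [e]
        refine (norm_add_le _ _).trans ?_
        rw [norm_smul, norm_smul, Real.norm_of_nonneg ht0, Real.norm_of_nonneg (by linarith)]
        have a1 := mul_le_mul_of_nonneg_left (hpw 0 (by omega)) (sub_nonneg.2 ht1)
        have a2 := mul_le_mul_of_nonneg_left (hpw' 0 (by omega)) ht0
        rw [zero_add] at a2
        linarith
      · rw [switchAt_of_le h, hy0]
        have := hU (t - d 0) ⟨by linarith, by linarith⟩
        rw [hw0] at this
        convert this using 2
        abel

end Concatenation

/-! ### Estimates for `log cosh` and `tanh`. -/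

section LogCosh

/-- The function `log ∘ cosh`. -/
noncomputable def logCosh (x : ℝ) : ℝ := Real.log (Real.cosh x)

lemma hasDerivAt_logCosh (x : ℝ) : HasDerivAt logCosh (Real.tanh x) x := by
  have h := (Real.hasDerivAt_cosh x).log (Real.cosh_pos x).ne'
  rwa [← Real.tanh_eq_sinh_div_cosh] at h

lemma abs_tanh_le_one (x : ℝ) : |Real.tanh x| ≤ 1 := (Real.abs_tanh_lt_one x).le

lemma logCosh_zero : logCosh 0 = 0 := by simp [logCosh]

lemma logCosh_neg (x : ℝ) : logCosh (-x) = logCosh x := by simp [logCosh]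

lemma logCosh_nonneg (x : ℝ) : 0 ≤ logCosh x := Real.log_nonneg (Real.one_le_cosh x)

lemma hasDerivAt_tanh (x : ℝ) : HasDerivAt Real.tanh (1 - Real.tanh x ^ 2) x := by
  have h := (Real.hasDerivAt_sinh x).div (Real.hasDerivAt_cosh x) (Real.cosh_pos x).ne'
  have e : Real.tanh = fun y => Real.sinh y / Real.cosh y := funext Real.tanh_eq_sinh_div_cosh
  have hc := (Real.cosh_pos x).ne'
  rw [e]
  refine h.congr_deriv ?_
  beta_reduce
  field_simp

lemma abs_tanh_sub_le (x y : ℝ) : |Real.tanh x - Real.tanh y| ≤ |x - y| := by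
  have := Convex.norm_image_sub_le_of_norm_hasDerivWithin_le (f := Real.tanh)
    (f' := fun x => 1 - Real.tanh x ^ 2) (C := 1) (s := Set.univ) (x := y) (y := x)
    (fun x _ => (hasDerivAt_tanh x).hasDerivWithinAt)
    (fun x _ => by
      have := (abs_le.1 (abs_tanh_le_one x))
      rw [Real.norm_eq_abs, abs_le]; constructor <;> nlinarith) convex_univ trivial trivial
  simpa using this

lemma abs_logCosh_sub_le (x y : ℝ) : |logCosh x - logCosh y| ≤ |x - y| := by
  have := Convex.norm_image_sub_le_of_norm_hasDerivWithin_le (f := logCosh)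
    (f' := Real.tanh) (C := 1) (s := Set.univ) (x := y) (y := x)
    (fun x _ => (hasDerivAt_logCosh x).hasDerivWithinAt)
    (fun x _ => abs_tanh_le_one x) convex_univ trivial trivial
  simpa using this

lemma logCosh_le_abs (x : ℝ) : logCosh x ≤ |x| := by
  have := abs_logCosh_sub_le x 0
  rw [logCosh_zero, sub_zero, sub_zero] at this
  exact (le_abs_self _).trans this

lemma tanh_monotone : Monotone Real.tanh :=
  monotone_of_hasDerivAt_nonneg hasDerivAt_tanh fun x => by
    have := (abs_le.1 (abs_tanh_le_one x))
    change 0 ≤ 1 - Real.tanh x ^ 2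
    nlinarith

/-- The graph of `log ∘ cosh` lies above its tangents. -/
lemma logCosh_tangent (x y : ℝ) : logCosh x + Real.tanh x * (y - x) ≤ logCosh y := by
  rcases lt_trichotomy x y with h | rfl | h
  · obtain ⟨c, hc, he⟩ := exists_hasDerivAt_eq_slope logCosh Real.tanh h
      (fun z _ => (hasDerivAt_logCosh z).continuousAt.continuousWithinAt)
      (fun z _ => hasDerivAt_logCosh z)
    have := tanh_monotone hc.1.le
    rw [he, le_div_iff₀ (by linarith)] at this
    linarith
  · simp
  · obtain ⟨c, hc, he⟩ := exists_hasDerivAt_eq_slope logCosh Real.tanh h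
      (fun z _ => (hasDerivAt_logCosh z).continuousAt.continuousWithinAt)
      (fun z _ => hasDerivAt_logCosh z)
    have := tanh_monotone hc.2.le
    rw [he, div_le_iff₀ (by linarith)] at this
    linarith

/-- The difference is `exp (-x) / cosh x`, and `x ≤ sinh x ≤ cosh x`. -/
lemma one_sub_tanh_le {x : ℝ} (hx : 0 < x) : 1 - Real.tanh x ≤ 1 / x := by
  have hc := Real.cosh_pos x
  rw [Real.tanh_eq_sinh_div_cosh, one_sub_div hc.ne', Real.cosh_sub_sinh,
    div_le_div_iff₀ hc hx]
  have h1 : x ≤ Real.sinh x := Real.self_le_sinh_iff.2 hx.le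
  have h2 : Real.sinh x ≤ Real.cosh x := (Real.sinh_lt_cosh x).le
  have h3 : Real.exp (-x) ≤ 1 := Real.exp_le_one_iff.2 (by linarith)
  nlinarith

end LogCosh

/-! ### The book equation and its derivative in the level. -/

section Book

/-- Signed distance to the spine direction of angle `a`. -/
noncomputable def spineDist (x y a : ℝ) : ℝ := x * Real.sin a - y * Real.cos a

/-- Coordinate along the spine direction of angle `a`. -/
noncomputable def spineCoord (x y a : ℝ) : ℝ := x * Real.cos a + y * Real.sin a

/-- The left-hand side of the book equation. -/
noncomputable def book (x y z a : ℝ) : ℝ :=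
  a + z - 1 / a * logCosh (a * spineDist x y a) - (x ^ 2 + y ^ 2) / (1 + a)

/-- The derivative of `book x y z a` in `a`. -/
noncomputable def bookDeriv (x y a : ℝ) : ℝ :=
  1 + logCosh (a * spineDist x y a) / a ^ 2
    - Real.tanh (a * spineDist x y a) * (spineDist x y a / a)
    - Real.tanh (a * spineDist x y a) * spineCoord x y a
    + (x ^ 2 + y ^ 2) / (1 + a) ^ 2

lemma hasDerivAt_spineDist (x y a : ℝ) :
    HasDerivAt (spineDist x y) (spineCoord x y a) a := by
  have := ((Real.hasDerivAt_sin a).const_mul x).sub ((Real.hasDerivAt_cos a).const_mul y)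
  refine this.congr_deriv ?_
  unfold spineCoord
  ring

lemma hasDerivAt_book (x y z : ℝ) {a : ℝ} (ha : 0 < a) :
    HasDerivAt (book x y z) (bookDeriv x y a) a := by
  have h1 := (hasDerivAt_logCosh (a * spineDist x y a)).comp a
    ((hasDerivAt_id a).mul (hasDerivAt_spineDist x y a))
  have h2 := (((hasDerivAt_id a).add_const z).sub
    (((hasDerivAt_const a (1 : ℝ)).div (hasDerivAt_id a) ha.ne').mul h1)).sub
    ((hasDerivAt_const a (x ^ 2 + y ^ 2)).div ((hasDerivAt_const a (1 : ℝ)).add (hasDerivAt_id a))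
      (by simp; positivity))
  refine h2.congr_deriv ?_
  have : 1 + a ≠ 0 := by positivity
  simp only [bookDeriv, id, Pi.add_apply, Pi.mul_apply, Pi.div_apply, Function.comp]
  field_simp
  ring

lemma spineDist_sq_add (x y a : ℝ) :
    spineDist x y a ^ 2 + spineCoord x y a ^ 2 = x ^ 2 + y ^ 2 := by
  unfold spineDist spineCoord
  linear_combination (x ^ 2 + y ^ 2) * Real.sin_sq_add_cos_sq a

variable {x y z a : ℝ}

lemma abs_spineDist_le (h : x ^ 2 + y ^ 2 ≤ (1 / 4) ^ 2) : |spineDist x y a| ≤ 1 / 4 :=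
  abs_le_of_sq_le_sq (by nlinarith [spineDist_sq_add x y a, sq_nonneg (spineCoord x y a)])
    (by norm_num)

lemma abs_spineCoord_le (h : x ^ 2 + y ^ 2 ≤ (1 / 4) ^ 2) : |spineCoord x y a| ≤ 1 / 4 :=
  abs_le_of_sq_le_sq (by nlinarith [spineDist_sq_add x y a, sq_nonneg (spineDist x y a)])
    (by norm_num)

lemma abs_tanh_mul_le {s c : ℝ} (t : ℝ) (h : |s| ≤ c) : |Real.tanh t * s| ≤ c := by
  rw [abs_mul]
  calc _ ≤ 1 * |s| := by gcongr; exact abs_tanh_le_one t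
    _ ≤ c := by simpa

/-- The tangent of `log cosh` at `a s`, evaluated at `0`, bounds the `log cosh` term by the first
`tanh` term. Since `r ≤ 1/4`, each of the other corrections is at most `1/4` in size. -/
lemma bookDeriv_mem (h : x ^ 2 + y ^ 2 ≤ (1 / 4) ^ 2) (ha : 1 ≤ a) :
    1 / 2 ≤ bookDeriv x y a ∧ bookDeriv x y a ≤ 3 / 2 := by
  have ha0 : 0 < a := by linarith
  set s := spineDist x y a with hs
  have h1 := abs_le.1 (abs_tanh_mul_le (a * s) (abs_spineCoord_le (a := a) h))
  have h2 : logCosh (a * s) / a ^ 2 ≤ Real.tanh (a * s) * (s / a) := by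
    rw [div_le_iff₀ (by positivity)]
    have := logCosh_tangent (a * s) 0
    rw [logCosh_zero] at this
    have e : Real.tanh (a * s) * (s / a) * a ^ 2 = Real.tanh (a * s) * (a * s) := by field_simp
    rw [e]; linarith
  have h3 : 0 ≤ logCosh (a * s) / a ^ 2 := div_nonneg (logCosh_nonneg _) (by positivity)
  have h4 : |s / a| ≤ 1 / 4 := by
    rw [abs_div, abs_of_pos ha0]
    exact (div_le_self (abs_nonneg _) ha).trans (abs_spineDist_le h)
  have h5 := abs_le.1 (abs_tanh_mul_le (a * s) h4)
  have h6 : 0 ≤ (x ^ 2 + y ^ 2) / (1 + a) ^ 2 := by positivity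
  have h7 : (x ^ 2 + y ^ 2) / (1 + a) ^ 2 ≤ 1 / 4 := by
    rw [div_le_iff₀ (by positivity)]; nlinarith
  unfold bookDeriv
  rw [← hs]
  constructor <;> linarith

lemma abs_spineDist_sub_le {x₀ y₀ a₀ d : ℝ} (h : x₀ ^ 2 + y₀ ^ 2 ≤ (1 / 4) ^ 2)
    (hx : |x - x₀| ≤ d) (hy : |y - y₀| ≤ d) :
    |spineDist x y a - spineDist x₀ y₀ a₀| ≤ 2 * d + |a - a₀| := by
  have h1 : |x₀| ≤ 1 / 4 := abs_le_of_sq_le_sq (by nlinarith [sq_nonneg y₀]) (by norm_num)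
  have h2 : |y₀| ≤ 1 / 4 := abs_le_of_sq_le_sq (by nlinarith [sq_nonneg x₀]) (by norm_num)
  have h3 : |Real.sin a - Real.sin a₀| ≤ |a - a₀| := by
    simpa [Real.dist_eq] using Real.lipschitzWith_sin.dist_le_mul a a₀
  have h4 : |Real.cos a - Real.cos a₀| ≤ |a - a₀| := by
    simpa [Real.dist_eq] using Real.lipschitzWith_cos.dist_le_mul a a₀
  have e : spineDist x y a - spineDist x₀ y₀ a₀ = (x - x₀) * Real.sin a
      + (-((y - y₀) * Real.cos a)) + (x₀ * (Real.sin a - Real.sin a₀)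
      + (-(y₀ * (Real.cos a - Real.cos a₀)))) := by unfold spineDist; ring
  rw [e]
  refine (abs_add_le _ _).trans ((add_le_add (abs_add_le _ _) (abs_add_le _ _)).trans ?_)
  rw [abs_neg, abs_neg, abs_mul, abs_mul, abs_mul, abs_mul]
  have g1 := mul_le_mul hx (Real.abs_sin_le_one a) (abs_nonneg _) ((abs_nonneg _).trans hx)
  have g2 := mul_le_mul hy (Real.abs_cos_le_one a) (abs_nonneg _) ((abs_nonneg _).trans hx)
  have g3 := mul_le_mul h1 h3 (abs_nonneg _) (by norm_num)
  have g4 := mul_le_mul h2 h4 (abs_nonneg _) (by norm_num)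
  linarith [abs_nonneg (a - a₀)]

lemma abs_spineCoord_sub_le {x₀ y₀ a₀ d : ℝ} (h : x₀ ^ 2 + y₀ ^ 2 ≤ (1 / 4) ^ 2)
    (hx : |x - x₀| ≤ d) (hy : |y - y₀| ≤ d) :
    |spineCoord x y a - spineCoord x₀ y₀ a₀| ≤ 2 * d + |a - a₀| := by
  have e : ∀ x y a, spineCoord x y a = spineDist y (-x) a := by
    intro x y a; unfold spineDist spineCoord; ring
  rw [e, e]
  refine abs_spineDist_sub_le (by nlinarith) hy ?_
  rwa [neg_sub_neg, abs_sub_comm]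

lemma abs_mul_sub_mul_le (p q r t : ℝ) : |p * q - r * t| ≤ |p - r| * |q| + |r| * |q - t| := by
  have e : p * q - r * t = (p - r) * q + r * (q - t) := by ring
  rw [e, ← abs_mul, ← abs_mul]
  exact abs_add_le _ _

lemma abs_inv_sub_inv_le {u v e : ℝ} (hu : 1 ≤ u) (hv : 1 ≤ v) (h : |u - v| ≤ e) :
    |u⁻¹ - v⁻¹| ≤ e := by
  rw [inv_sub_inv (by linarith) (by linarith), abs_div, abs_sub_comm, abs_of_pos (a := u * v)
    (by nlinarith)]
  exact (div_le_self (abs_nonneg _) (by nlinarith)).trans h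

lemma abs_inv_sq_sub_inv_sq_le {u v e : ℝ} (hu : 1 ≤ u) (hv : 1 ≤ v) (h : |u - v| ≤ e) :
    |(u ^ 2)⁻¹ - (v ^ 2)⁻¹| ≤ 2 * e := by
  have hi1 : u⁻¹ ≤ 1 := inv_le_one_of_one_le₀ hu
  have hi0 : v⁻¹ ≤ 1 := inv_le_one_of_one_le₀ hv
  have hi1' : 0 < u⁻¹ := inv_pos.2 (by linarith)
  have hi0' : 0 < v⁻¹ := inv_pos.2 (by linarith)
  have : (u ^ 2)⁻¹ - (v ^ 2)⁻¹ = (u⁻¹ - v⁻¹) * (u⁻¹ + v⁻¹) := by ring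
  rw [this, abs_mul, abs_of_pos (add_pos hi1' hi0'), mul_comm 2]
  have := abs_inv_sub_inv_le hu hv h
  exact mul_le_mul this (by linarith) (by positivity) ((abs_nonneg _).trans h)

section Terms

variable {s s₀ a₀ e : ℝ}

/-- A source of the factor `a₀` in the Lipschitz constants: the argument `a s` varies at rate `a` in
`s`. -/
lemma abs_scaled_sub_le (ha₀ : 1 ≤ a₀) (hδ : |a - a₀| ≤ e) (h1 : |s - s₀| ≤ e)
    (hsb : |s| ≤ 1 / 4) : |a * s - a₀ * s₀| ≤ 2 * (a₀ * e) := by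
  have e0 : 0 ≤ e := (abs_nonneg _).trans hδ
  refine (abs_mul_sub_mul_le _ _ _ _).trans ?_
  rw [abs_of_pos (a := a₀) (by linarith)]
  have := mul_le_mul hδ hsb (abs_nonneg _) e0
  have := mul_le_mul_of_nonneg_left h1 (a := a₀) (by linarith)
  nlinarith

lemma abs_logCosh_term_sub_le (ha : 1 ≤ a) (ha₀ : 1 ≤ a₀) (hδ : |a - a₀| ≤ e)
    (h1 : |s - s₀| ≤ e) (hsb : |s| ≤ 1 / 4) (hs0b : |s₀| ≤ 1 / 4) :
    |logCosh (a * s) / a ^ 2 - logCosh (a₀ * s₀) / a₀ ^ 2| ≤ 3 * (a₀ * e) := by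
  have e0 : 0 ≤ e := (abs_nonneg _).trans hδ
  have ha₀' : 0 < a₀ := by linarith
  have hl := (abs_logCosh_sub_le (a * s) (a₀ * s₀)).trans (abs_scaled_sub_le ha₀ hδ h1 hsb)
  rw [div_eq_mul_inv, div_eq_mul_inv]
  refine (abs_mul_sub_mul_le _ _ _ _).trans ?_
  have k1 : |(a ^ 2)⁻¹| ≤ 1 := by
    rw [abs_of_pos (by positivity)]; exact inv_le_one_of_one_le₀ (by nlinarith)
  have k2 : |logCosh (a₀ * s₀)| ≤ a₀ / 4 := by
    rw [abs_of_nonneg (logCosh_nonneg _)]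
    refine (logCosh_le_abs _).trans ?_
    rw [abs_mul, abs_of_pos ha₀']; nlinarith
  have k3 := abs_inv_sq_sub_inv_sq_le ha ha₀ hδ
  have k4 := mul_le_mul hl k1 (abs_nonneg _) (by positivity)
  have k5 := mul_le_mul k2 k3 (abs_nonneg _) (by positivity)
  linarith [mul_nonneg ha₀'.le e0]

lemma abs_tanh_term_sub_le {c c₀ e' : ℝ} (ha₀ : 1 ≤ a₀) (hδ : |a - a₀| ≤ e)
    (h1 : |s - s₀| ≤ e) (hsb : |s| ≤ 1 / 4) (hcb : |c| ≤ 1 / 4) (hc : |c - c₀| ≤ e') :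
    |Real.tanh (a * s) * c - Real.tanh (a₀ * s₀) * c₀| ≤ a₀ * e + e' := by
  have e0 : 0 ≤ e := (abs_nonneg _).trans hδ
  have e0' : 0 ≤ e' := (abs_nonneg _).trans hc
  have ha₀' : 0 < a₀ := by linarith
  have ht := (abs_tanh_sub_le (a * s) (a₀ * s₀)).trans (abs_scaled_sub_le ha₀ hδ h1 hsb)
  refine (abs_mul_sub_mul_le _ _ _ _).trans ?_
  have k2 := mul_le_mul ht hcb (abs_nonneg _) (by positivity)
  have k3 := mul_le_mul (abs_tanh_le_one (a₀ * s₀)) hc (abs_nonneg _) (by positivity)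
  linarith [mul_nonneg ha₀'.le e0]

lemma abs_ratio_sub_le (ha : 1 ≤ a) (ha₀ : 1 ≤ a₀) (hδ : |a - a₀| ≤ e)
    (h1 : |s - s₀| ≤ e) (hs0b : |s₀| ≤ 1 / 4) : |s / a - s₀ / a₀| ≤ 2 * e := by
  have e0 : 0 ≤ e := (abs_nonneg _).trans hδ
  rw [div_eq_mul_inv, div_eq_mul_inv]
  refine (abs_mul_sub_mul_le _ _ _ _).trans ?_
  have k1 : |a⁻¹| ≤ 1 := by
    rw [abs_of_pos (by positivity)]; exact inv_le_one_of_one_le₀ ha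
  have := mul_le_mul h1 k1 (abs_nonneg _) e0
  have := mul_le_mul hs0b (abs_inv_sub_inv_le ha ha₀ hδ) (abs_nonneg _) (by norm_num)
  linarith

end Terms

lemma abs_radius_term_sub_le {x₀ y₀ a₀ d e : ℝ} (h : x ^ 2 + y ^ 2 ≤ (1 / 4) ^ 2)
    (h₀ : x₀ ^ 2 + y₀ ^ 2 ≤ (1 / 4) ^ 2) (ha : 1 ≤ a) (ha₀ : 1 ≤ a₀)
    (hx : |x - x₀| ≤ d) (hy : |y - y₀| ≤ d) (hde : 2 * d ≤ e) (hδ : |a - a₀| ≤ e) :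
    |(x ^ 2 + y ^ 2) / (1 + a) ^ 2 - (x₀ ^ 2 + y₀ ^ 2) / (1 + a₀) ^ 2| ≤ 4 * e := by
  have hd : 0 ≤ d := (abs_nonneg _).trans hx
  have hx0 : |x₀| ≤ 1 / 4 := abs_le_of_sq_le_sq (by nlinarith [sq_nonneg y₀]) (by norm_num)
  have hy0 : |y₀| ≤ 1 / 4 := abs_le_of_sq_le_sq (by nlinarith [sq_nonneg x₀]) (by norm_num)
  have hx1 : |x| ≤ 1 / 4 := abs_le_of_sq_le_sq (by nlinarith [sq_nonneg y]) (by norm_num)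
  have hy1 : |y| ≤ 1 / 4 := abs_le_of_sq_le_sq (by nlinarith [sq_nonneg x]) (by norm_num)
  rw [div_eq_mul_inv, div_eq_mul_inv]
  refine (abs_mul_sub_mul_le _ _ _ _).trans ?_
  have k1 : |((1 + a) ^ 2)⁻¹| ≤ 1 := by
    rw [abs_of_pos (by positivity)]; exact inv_le_one_of_one_le₀ (by nlinarith)
  have k3 := abs_inv_sq_sub_inv_sq_le (u := 1 + a) (v := 1 + a₀) (e := e) (by linarith) (by linarith)
    (by rwa [add_sub_add_left_eq_sub])
  have k4 : |x ^ 2 + y ^ 2 - (x₀ ^ 2 + y₀ ^ 2)| ≤ e := by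
    have : x ^ 2 + y ^ 2 - (x₀ ^ 2 + y₀ ^ 2) = (x - x₀) * (x + x₀) + (y - y₀) * (y + y₀) := by
      ring
    rw [this]
    refine (abs_add_le _ _).trans ?_
    rw [abs_mul, abs_mul]
    have g1 := mul_le_mul hx ((abs_add_le x x₀).trans (add_le_add hx1 hx0)) (abs_nonneg _) hd
    have g2 := mul_le_mul hy ((abs_add_le y y₀).trans (add_le_add hy1 hy0)) (abs_nonneg _) hd
    linarith
  have k5 : |x₀ ^ 2 + y₀ ^ 2| ≤ 1 := by
    rw [abs_of_nonneg (by positivity)]; linarith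
  have k6 := mul_le_mul k4 k1 (abs_nonneg _) (by linarith)
  have k7 := mul_le_mul k5 k3 (abs_nonneg _) (by linarith)
  linarith

/-- The derivative of the book equation is Lipschitz at `(x₀, y₀, a₀)` with constant `O(a₀)`. -/
lemma abs_bookDeriv_sub_le {x₀ y₀ a₀ d : ℝ} (h : x ^ 2 + y ^ 2 ≤ (1 / 4) ^ 2)
    (h₀ : x₀ ^ 2 + y₀ ^ 2 ≤ (1 / 4) ^ 2) (ha : 1 ≤ a) (ha₀ : 1 ≤ a₀)
    (hx : |x - x₀| ≤ d) (hy : |y - y₀| ≤ d) :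
    |bookDeriv x y a - bookDeriv x₀ y₀ a₀| ≤ 24 * a₀ * (d + |a - a₀|) := by
  have hd : 0 ≤ d := (abs_nonneg _).trans hx
  set e := 2 * d + |a - a₀| with he
  have hδ : |a - a₀| ≤ e := by linarith
  have e0 : 0 ≤ e := (abs_nonneg _).trans hδ
  have hae : e ≤ a₀ * e := le_mul_of_one_le_left e0 ha₀
  have h1 : |spineDist x y a - spineDist x₀ y₀ a₀| ≤ e := abs_spineDist_sub_le h₀ hx hy
  have h2 : |spineCoord x y a - spineCoord x₀ y₀ a₀| ≤ e := abs_spineCoord_sub_le h₀ hx hy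
  have hsb : |spineDist x y a| ≤ 1 / 4 := abs_spineDist_le h
  have hs0b : |spineDist x₀ y₀ a₀| ≤ 1 / 4 := abs_spineDist_le h₀
  have hsa : |spineDist x y a / a| ≤ 1 / 4 := by
    rw [abs_div, abs_of_pos (a := a) (by linarith)]
    exact (div_le_self (abs_nonneg _) ha).trans hsb
  have t1 := abs_le.1 (abs_logCosh_term_sub_le ha ha₀ hδ h1 hsb hs0b)
  have t2 := abs_le.1 (abs_tanh_term_sub_le ha₀ hδ h1 hsb hsa
    (abs_ratio_sub_le ha ha₀ hδ h1 hs0b))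
  have t3 := abs_le.1 (abs_tanh_term_sub_le ha₀ hδ h1 hsb (abs_spineCoord_le h) h2)
  have t4 := abs_le.1 (abs_radius_term_sub_le h h₀ ha ha₀ hx hy
    (by linarith [abs_nonneg (a - a₀)]) hδ)
  -- The four terms contribute `5 a₀ e + 7 e ≤ 12 a₀ e`, and `e` costs another factor two: hence 24.
  have h5 : e ≤ 2 * (d + |a - a₀|) := by linarith [abs_nonneg (a - a₀)]
  have := mul_le_mul_of_nonneg_left h5 (a := a₀) (by linarith)
  unfold bookDeriv
  rw [abs_le]
  constructor <;> linarith

end Book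

/-! ### Strict tangent inequality for the composed function. -/

section Tangent

/-- The composition function `h`, growing fast enough to make `h ∘ f` convex. -/
noncomputable def height (a : ℝ) : ℝ := Real.exp (60000 * Real.exp a)

/-- The logarithmic derivative of `height`. -/
noncomputable def heightRate (a : ℝ) : ℝ := 60000 * Real.exp a

lemma height_strictMono : StrictMono height := fun _ _ h =>
  Real.exp_lt_exp.2 (by have := Real.exp_lt_exp.2 h; linarith)

lemma height_contDiff : ContDiff ℝ 2 height := by unfold height; fun_prop

lemma height_pos (a : ℝ) : 0 < height a := Real.exp_pos _

lemma heightRate_pos (a : ℝ) : 0 < heightRate a := by unfold heightRate; positivity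

/-- From `exp a ≥ a ^ 3 / 6`. The constant 60000 is chosen to exceed the `8 * 1200 * a ^ 3` that
`rate_mul_lt` needs. -/
lemma heightRate_ge {a : ℝ} (ha : 1 ≤ a) : 10000 * a ^ 3 ≤ heightRate a := by
  have := Real.pow_div_factorial_le_exp a (by linarith) 3
  norm_num [Nat.factorial] at this
  unfold heightRate
  linarith

/-- `height` is log-convex: `60000 * exp` lies above its tangent at `a₀`. -/
lemma height_mul_exp_le (a a₀ : ℝ) :
    height a₀ * Real.exp (heightRate a₀ * (a - a₀)) ≤ height a := by
  unfold height heightRate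
  rw [← Real.exp_add]
  apply Real.exp_le_exp.2
  have := Real.add_one_le_exp (a - a₀)
  have h : Real.exp a = Real.exp a₀ * Real.exp (a - a₀) := by rw [← Real.exp_add]; ring_nf
  rw [h]
  nlinarith [Real.exp_pos a₀]

/-- For `-2 ≤ x < 0` the quadratic bound is beaten by `exp x ≥ (1 + x / 2) ^ 2`. For very negative
`x` it is useless, and the linear bound takes over to keep `b` below `-1`. -/
lemma lt_exp_sub_one {x b : ℝ} (hx : x ≠ 0) (h1 : b ≤ x + x ^ 2 / 8) (h2 : x < 0 → b ≤ x / 3) :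
    b < Real.exp x - 1 := by
  have hx2 : 0 < x ^ 2 := by positivity
  rcases lt_or_gt_of_ne hx with h | h
  · specialize h2 h
    by_cases h3 : -2 ≤ x
    · have := Real.add_one_le_exp (x / 2)
      have e : Real.exp x = Real.exp (x / 2) ^ 2 := by rw [← Real.exp_nat_mul]; ring_nf
      rw [e]; nlinarith
    · have := Real.exp_pos x
      by_cases h4 : -4 ≤ x <;> nlinarith
  · have := Real.quadratic_le_exp_of_nonneg h.le
    linarith

variable {x y z a x₀ y₀ z₀ a₀ : ℝ}

/-- The value at `(u, v, w)` of the derivative of `book · · · a` at `(x, y, z)`. -/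
noncomputable def bookSlope (x y a u v w : ℝ) : ℝ :=
  w - Real.tanh (a * spineDist x y a) * spineDist u v a - 2 * (x * u + y * v) / (1 + a)

/-- Concavity in the point: `log cosh` lies above its tangents, and the `r²` term leaves an exact
quadratic remainder, the source of strictness within a level. -/
lemma book_le_tangent (ha : 0 < a) :
    book x y z a ≤ book x₀ y₀ z₀ a + bookSlope x₀ y₀ a (x - x₀) (y - y₀) (z - z₀)
      - ((x - x₀) ^ 2 + (y - y₀) ^ 2) / (1 + a) := by
  have h := logCosh_tangent (a * spineDist x₀ y₀ a) (a * spineDist x y a)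
  have e1 : spineDist (x - x₀) (y - y₀) a = spineDist x y a - spineDist x₀ y₀ a := by
    unfold spineDist; ring
  have e2 : (x ^ 2 + y ^ 2) / (1 + a) = (x₀ ^ 2 + y₀ ^ 2) / (1 + a)
      + 2 * (x₀ * (x - x₀) + y₀ * (y - y₀)) / (1 + a)
      + ((x - x₀) ^ 2 + (y - y₀) ^ 2) / (1 + a) := by field_simp; ring
  unfold book bookSlope
  rw [e1, e2]
  set T := Real.tanh (a * spineDist x₀ y₀ a)
  set s := spineDist x y a
  set s₀ := spineDist x₀ y₀ a
  have h' := mul_le_mul_of_nonneg_left h (one_div_pos.2 ha).le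
  have e3 : 1 / a * (logCosh (a * s₀) + T * (a * s - a * s₀))
      = 1 / a * logCosh (a * s₀) + T * (s - s₀) := by field_simp
  rw [e3] at h'
  linarith

lemma book_mean_value (x y z : ℝ) (ha : 0 < a) (ha₀ : 0 < a₀) :
    ∃ c, min a a₀ ≤ c ∧ |c - a₀| ≤ |a - a₀| ∧
      book x y z a - book x y z a₀ = bookDeriv x y c * (a - a₀) := by
  rcases lt_trichotomy a a₀ with h | rfl | h
  · obtain ⟨c, hc, he⟩ := exists_hasDerivAt_eq_slope (book x y z) (bookDeriv x y) h
      (fun u hu => (hasDerivAt_book x y z (ha.trans_le hu.1)).continuousAt.continuousWithinAt)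
      (fun u hu => hasDerivAt_book x y z (ha.trans hu.1))
    refine ⟨c, by simp [hc.1.le], ?_, ?_⟩
    · rw [abs_of_neg (by linarith [hc.2]), abs_of_neg (by linarith)]; linarith [hc.1]
    · rw [he]; field_simp [sub_ne_zero.2 h.ne']; ring
  · exact ⟨a, by simp, le_rfl, by ring⟩
  · obtain ⟨c, hc, he⟩ := exists_hasDerivAt_eq_slope (book x y z) (bookDeriv x y) h
      (fun u hu => (hasDerivAt_book x y z (ha₀.trans_le hu.1)).continuousAt.continuousWithinAt)
      (fun u hu => hasDerivAt_book x y z (ha₀.trans hu.1))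
    refine ⟨c, by simp [hc.1.le], ?_, ?_⟩
    · rw [abs_of_pos (by linarith [hc.1]), abs_of_pos (by linarith)]; linarith [hc.2]
    · rw [he]; field_simp [sub_ne_zero.2 h.ne']

/-- The book equation grows with slope between `1 / 2` and `3 / 2`. -/
lemma book_slope_bounds (h : x ^ 2 + y ^ 2 ≤ (1 / 4) ^ 2) (ha₀ : 1 ≤ a₀) (haa : a₀ ≤ a) :
    (a - a₀) / 2 ≤ book x y z a - book x y z a₀ ∧
      book x y z a - book x y z a₀ ≤ 3 / 2 * (a - a₀) := by
  obtain ⟨c, hc, -, he⟩ := book_mean_value x y z (a := a) (a₀ := a₀) (by linarith) (by linarith)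
  have := bookDeriv_mem h (a := c) (by rw [min_eq_right haa] at hc; linarith)
  rw [he]
  constructor <;> nlinarith

/-- Completing the square: the cross term `24 a₀ d |t|` is absorbed by `d ^ 2 / (1 + a₀)` at the
cost of `144 a₀² (1 + a₀) t²`. -/
lemma quadratic_error_bound {d t D E B : ℝ} (ha₀ : 1 ≤ a₀)
    (hDB : D * B ≤ E * t - d ^ 2 / (1 + a₀)) (hlip : |E - D| ≤ 24 * a₀ * (d + |t|)) :
    D * B ≤ D * t + 600 * a₀ ^ 3 * t ^ 2 := by
  have e2 : E * t ≤ D * t + 24 * a₀ * (d + |t|) * |t| := by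
    have := (abs_le.1 ((abs_mul (E - D) t).le.trans
      (mul_le_mul_of_nonneg_right hlip (abs_nonneg t)))).2
    linarith
  have g5 : |t| * |t| = t ^ 2 := by rw [abs_mul_abs_self]; ring
  have e3 : 24 * a₀ * (d * |t|) - d ^ 2 / (1 + a₀) ≤ 144 * (a₀ ^ 2 * (1 + a₀) * t ^ 2) := by
    rw [sub_le_iff_le_add, ← sub_le_iff_le_add', le_div_iff₀ (by positivity), ← g5]
    have := sq_nonneg (d - 12 * a₀ * (1 + a₀) * |t|)
    linarith
  have g1 : a₀ ≤ a₀ ^ 3 := le_self_pow₀ ha₀ (by norm_num)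
  have g2 : a₀ ^ 2 * (1 + a₀) ≤ 2 * a₀ ^ 3 := by
    have : a₀ ^ 2 ≤ a₀ ^ 3 := pow_le_pow_right₀ ha₀ (by norm_num)
    linarith
  have g3 := mul_le_mul_of_nonneg_right g1 (sq_nonneg t)
  have g4 := mul_le_mul_of_nonneg_right g2 (sq_nonneg t)
  have g6 : 0 ≤ a₀ ^ 3 * t ^ 2 := by positivity
  have e5 : 24 * a₀ * (d + |t|) * |t| = 24 * a₀ * (d * |t|) + 24 * (a₀ * t ^ 2) := by
    rw [← g5]; ring
  linarith

/-- Here `t` is the true increment of the level and `B` the linearly predicted one. The excess of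
`B` over `t` is `O(a₀³ t²)`, which the second-order term of `exp (κ t)` beats; for `t < 0` moreover
`B ≤ t / 3`. -/
lemma rate_mul_lt {κ d t D E B : ℝ} (ha₀ : 1 ≤ a₀) (hκ : 0 < κ)
    (hκ3 : 10000 * a₀ ^ 3 ≤ κ) (hD1 : 1 / 2 ≤ D) (hD2 : D ≤ 3 / 2) (hE : 1 / 2 ≤ E) (h0 : t ≠ 0)
    (hDB : D * B ≤ E * t - d ^ 2 / (1 + a₀)) (hlip : |E - D| ≤ 24 * a₀ * (d + |t|)) :
    κ * B < Real.exp (κ * t) - 1 := by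
  have hD0 : 0 < D := by linarith
  have e4 := quadratic_error_bound ha₀ hDB hlip
  have g6 : 0 ≤ a₀ ^ 3 * t ^ 2 := by positivity
  have e5 : B ≤ t + 1200 * (a₀ ^ 3 * t ^ 2) := by
    refine le_of_mul_le_mul_left (a := D) ?_ hD0
    have := mul_le_mul_of_nonneg_right hD1 g6
    linarith
  apply lt_exp_sub_one (mul_ne_zero hκ.ne' h0)
  · have g7 := mul_le_mul_of_nonneg_right hκ3 (sq_nonneg t)
    have e6 : B ≤ t + κ * t ^ 2 / 8 := by linarith
    have := mul_le_mul_of_nonneg_left e6 hκ.le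
    linarith
  · intro hneg
    have ht0 : t < 0 := by
      by_contra hcon
      exact absurd hneg (not_lt.2 (mul_nonneg hκ.le (not_lt.1 hcon)))
    have hda : 0 ≤ d ^ 2 / (1 + a₀) := by positivity
    have g8 : D * B ≤ t / 2 := by nlinarith
    have g9 : B ≤ t / 3 := by
      refine le_of_mul_le_mul_left (a := D) ?_ hD0
      nlinarith
    have := mul_le_mul_of_nonneg_left g9 hκ.le
    linarith

/-- The level function `height ∘ f` lies strictly above its tangents. -/
lemma height_tangent_lt (h : x ^ 2 + y ^ 2 ≤ (1 / 4) ^ 2) (h₀ : x₀ ^ 2 + y₀ ^ 2 ≤ (1 / 4) ^ 2)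
    (ha : 1 ≤ a) (ha₀ : 1 ≤ a₀) (hb : book x y z a = 0) (hb₀ : book x₀ y₀ z₀ a₀ = 0)
    (hne : ¬ (x = x₀ ∧ y = y₀ ∧ z = z₀)) :
    height a₀ - height a₀ * heightRate a₀ / bookDeriv x₀ y₀ a₀
      * bookSlope x₀ y₀ a₀ (x - x₀) (y - y₀) (z - z₀) < height a := by
  set D := bookDeriv x₀ y₀ a₀ with hD
  set B := -bookSlope x₀ y₀ a₀ (x - x₀) (y - y₀) (z - z₀) / D with hB
  set d := √((x - x₀) ^ 2 + (y - y₀) ^ 2) with hd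
  have hdd : d ^ 2 = (x - x₀) ^ 2 + (y - y₀) ^ 2 := Real.sq_sqrt (by positivity)
  have hd0 : 0 ≤ d := Real.sqrt_nonneg _
  have hκ := heightRate_pos a₀
  have hκ3 := heightRate_ge ha₀
  set κ := heightRate a₀ with hκd
  set t := a - a₀ with ht
  obtain ⟨hD1, hD2⟩ := bookDeriv_mem h₀ ha₀
  rw [← hD] at hD1 hD2
  have hD0 : 0 < D := by linarith
  obtain ⟨c, hc1, hc2, hc3⟩ := book_mean_value x y z (a := a) (a₀ := a₀) (by linarith)
    (by linarith)
  have hc : 1 ≤ c := (le_min ha ha₀).trans hc1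
  have htan := book_le_tangent (x := x) (y := y) (z := z) (x₀ := x₀) (y₀ := y₀) (z₀ := z₀)
    (a := a₀) (by linarith)
  rw [hb] at hc3
  rw [hb₀, ← hdd] at htan
  have hDB : D * B ≤ bookDeriv x y c * t - d ^ 2 / (1 + a₀) := by
    rw [hB, mul_div_cancel₀ _ hD0.ne']
    linarith
  have hlip : |bookDeriv x y c - D| ≤ 24 * a₀ * (d + |t|) := by
    refine (abs_bookDeriv_sub_le (d := d) h h₀ hc ha₀ ?_ ?_).trans ?_
    · exact Real.abs_le_sqrt (by nlinarith [sq_nonneg (y - y₀)])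
    · exact Real.abs_le_sqrt (by nlinarith [sq_nonneg (x - x₀)])
    · gcongr
  have key : κ * B < Real.exp (κ * t) - 1 := by
    -- Within one level the strictness comes from `d`; if `d` vanished too, the equation would force
    -- equal heights.
    rcases eq_or_ne t 0 with h0 | h0
    · have hpos : 0 < d ^ 2 := by
        rw [hdd]
        by_contra hcon
        have hx0 : x - x₀ = 0 := by nlinarith [sq_nonneg (x - x₀), sq_nonneg (y - y₀)]
        have hy0 : y - y₀ = 0 := by nlinarith [sq_nonneg (x - x₀), sq_nonneg (y - y₀)]
        have ex : x = x₀ := sub_eq_zero.1 hx0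
        have ey : y = y₀ := sub_eq_zero.1 hy0
        have ea : a = a₀ := sub_eq_zero.1 h0
        refine hne ⟨ex, ey, ?_⟩
        rw [ex, ey, ea] at hb
        unfold book at hb hb₀
        linarith
      have : 0 < d ^ 2 / (1 + a₀) := by positivity
      rw [h0, mul_zero, zero_sub] at hDB
      have hBneg : B < 0 := by
        by_contra hcon
        have := mul_nonneg hD0.le (not_lt.1 hcon)
        linarith
      rw [h0, mul_zero, Real.exp_zero, sub_self]
      exact mul_neg_of_pos_of_neg hκ hBneg
    · exact rate_mul_lt ha₀ hκ hκ3 hD1 hD2 (bookDeriv_mem h hc).1 h0 hDB hlip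
  have h5 := height_mul_exp_le a a₀
  have h6 : height a₀ * heightRate a₀ / D * bookSlope x₀ y₀ a₀ (x - x₀) (y - y₀) (z - z₀)
      = - (height a₀ * (κ * B)) := by rw [hB]; ring
  rw [h6]
  have := mul_lt_mul_of_pos_left key (height_pos a₀)
  linarith

end Tangent

/-! ### Unperturbed motion along the axis. -/

section AxisTrajectory

/-- The point of the `z`-axis at height `z`. -/
noncomputable def axisPoint (z : ℝ) : E3 := EuclideanSpace.single 2 z

lemma inner_axisPoint (g : E3) (z : ℝ) : ⟪g, axisPoint z⟫ = g 2 * z := by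
  simp [axisPoint, EuclideanSpace.inner_single_right, mul_comm]

lemma axisPoint_add_smul (z t m : ℝ) :
    axisPoint z + t • axisPoint m = axisPoint (z + t * m) := by
  unfold axisPoint
  ext i
  fin_cases i <;> simp

/-- If the maximum of a locally finite affine family has subgradients along the axis, then an
unperturbed trajectory moves up the axis from each of its points. -/
lemma LocallyFewAffine.exists_axis_trajectory {ι : Type*} {g : ι → E3} {b : ι → ℝ} [Nonempty ι]
    (h : LocallyFewAffine g b) (hpos : ∀ j, g j 2 < 0)
    (hsub : ∀ j z, maxAffine g b (axisPoint z) = ⟪g j, axisPoint z⟫ + b j →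
      axisPoint (-g j 2) ∈ subgradientField (maxAffine g b) (axisPoint z))
    (hfin : ∀ m : ℝ, {j | m < g j 2}.Finite) (z : ℝ) :
    ∃ x, IsUnperturbedTrajectory (subgradientField (maxAffine g b)) x ∧ x 0 = axisPoint z ∧
      ∀ t, 0 ≤ t → ∃ z', x t = axisPoint z' := by
  -- Moving up, only pieces of larger axial slope can overtake the active one. Their number is
  -- finite and drops at each change, which gives the induction.
  suffices H : ∀ (n : ℕ) (z : ℝ) (j : ι), {i | g j 2 < g i 2}.ncard = n →
      maxAffine g b (axisPoint z) = ⟪g j, axisPoint z⟫ + b j →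
      ∃ x, IsUnperturbedTrajectory (subgradientField (maxAffine g b)) x ∧ x 0 = axisPoint z ∧
      ∀ t, 0 ≤ t → ∃ z', x t = axisPoint z' by
    obtain ⟨j, hj⟩ := h.exists_eq (axisPoint z)
    exact H _ z j rfl hj
  intro n
  induction n using Nat.strong_induction_on with
  | _ n ih =>
  intro z j hn hj
  have hle : ∀ i, g i 2 * z + b i ≤ g j 2 * z + b j := fun i => by
    have := h.le_maxAffine (axisPoint z) i
    rwa [hj, inner_axisPoint, inner_axisPoint] at this
  have hactive : ∀ z', (∀ i, g i 2 * z' + b i ≤ g j 2 * z' + b j) →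
      maxAffine g b (axisPoint z') = ⟪g j, axisPoint z'⟫ + b j := fun z' hz' =>
    le_antisymm (maxAffine_le fun i => by rw [inner_axisPoint, inner_axisPoint]; exact hz' i)
      (h.le_maxAffine _ j)
  have hlow : ∀ z', z ≤ z' → ∀ i, g i 2 ≤ g j 2 → g i 2 * z' + b i ≤ g j 2 * z' + b j := by
    intro z' hz' i hi
    have := hle i
    nlinarith
  rcases Set.eq_empty_or_nonempty {i | g j 2 < g i 2} with hI | hI
  · have hmem : ∀ t : ℝ, 0 ≤ t → axisPoint (-g j 2) ∈
        subgradientField (maxAffine g b) (axisPoint z + t • axisPoint (-g j 2)) := by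
      intro t ht
      rw [axisPoint_add_smul]
      refine hsub j _ (hactive _ fun i => hlow _ (by nlinarith [hpos j]) i ?_)
      by_contra hcon
      have : i ∈ {i | g j 2 < g i 2} := not_le.1 hcon
      rw [hI] at this
      exact this
    have := isPerturbedTrajectory_line _ _ _ hmem
    rw [sub_self] at this
    simp only [smul_zero] at this
    exact ⟨_, this, by simp, fun t _ => ⟨_, axisPoint_add_smul _ _ _⟩⟩
  · obtain ⟨i, hi, hmin⟩ := Set.exists_min_image _
      (fun i => (b j - b i) / (g i 2 - g j 2)) (hfin (g j 2)) hI
    -- The first height at which a piece of larger slope catches up with `j`.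
    set c := (b j - b i) / (g i 2 - g j 2) with hc
    have hgi : 0 < g i 2 - g j 2 := sub_pos.2 hi
    have hzc : z ≤ c := by
      rw [hc, le_div_iff₀ hgi]
      linarith [hle i]
    have hbelow : ∀ z', z ≤ z' → z' ≤ c → ∀ k, g k 2 * z' + b k ≤ g j 2 * z' + b j := by
      intro z' h1 h2 k
      rcases le_or_gt (g k 2) (g j 2) with hk | hk
      · exact hlow z' h1 k hk
      · have := h2.trans (hmin k hk)
        rw [le_div_iff₀ (sub_pos.2 hk)] at this
        linarith
    have hic : maxAffine g b (axisPoint c) = ⟪g i, axisPoint c⟫ + b i := by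
      rw [hactive c (hbelow c hzc le_rfl), inner_axisPoint, inner_axisPoint]
      have : c * (g i 2 - g j 2) = b j - b i := div_mul_cancel₀ _ hgi.ne'
      linarith
    obtain ⟨x, hx, hx0, hxa⟩ := ih _ (by
      rw [← hn]
      exact Set.ncard_lt_ncard ⟨fun k (hk : g i 2 < g k 2) => hi.trans hk,
        fun hcon => lt_irrefl (g i 2) (hcon hi)⟩ (hfin _)) c i rfl hic
    rcases hzc.eq_or_lt with hzc' | hzc'
    · rw [hzc']
      exact ⟨x, hx, hx0, hxa⟩
    · have hm : 0 < -g j 2 := by linarith [hpos j]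
      have hd : 0 < (c - z) / -g j 2 := div_pos (sub_pos.2 hzc') hm
      refine ⟨_, hx.prepend (axisPoint z) (axisPoint (-g j 2)) hd (fun t ht => ?_) ?_, ?_, ?_⟩
      · have h1 := (lt_div_iff₀ hm).1 ht.2
        have h2 := mul_nonneg ht.1 hm.le
        rw [axisPoint_add_smul]
        exact hsub j _ (hactive _ (hbelow _ (by linarith) (by linarith)))
      · rw [hx0, axisPoint_add_smul, div_mul_cancel₀ _ hm.ne', add_sub_cancel]
      · rw [switchAt_of_lt hd]; simp
      · intro t ht
        rcases lt_or_ge t ((c - z) / -g j 2) with h1 | h1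
        · rw [switchAt_of_lt h1]
          exact ⟨_, axisPoint_add_smul _ _ _⟩
        · rw [switchAt_of_le h1]
          exact hxa _ (by linarith)

end AxisTrajectory

/-! ### Strict convexity from strict tangents. -/

section StrictConvexity

/-- A function lying strictly above an affine tangent at each point is strictly convex. -/
lemma strictConvexOn_of_tangent {E : Type*} [NormedAddCommGroup E] [InnerProductSpace ℝ E]
    {s : Set E} (hs : Convex ℝ s) {Φ : E → ℝ} {G : E → E}
    (h : ∀ p₀ ∈ s, ∀ p ∈ s, p ≠ p₀ → Φ p₀ + ⟪G p₀, p - p₀⟫ < Φ p) : StrictConvexOn ℝ s Φ := by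
  refine ⟨hs, fun x hx y hy hxy a b ha hb hab => ?_⟩
  set m := a • x + b • y with hm
  have hms : m ∈ s := hs hx hy ha.le hb.le hab
  have ex : x - m = b • (x - y) := by
    rw [hm, eq_sub_of_add_eq hab]; module
  have ey : y - m = a • (y - x) := by
    rw [hm, eq_sub_of_add_eq' hab]; module
  have hxm : x ≠ m := by
    rw [← sub_ne_zero, ex]; exact smul_ne_zero hb.ne' (sub_ne_zero.2 hxy)
  have hym : y ≠ m := by
    rw [← sub_ne_zero, ey]; exact smul_ne_zero ha.ne' (sub_ne_zero.2 hxy.symm)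
  have h1 := mul_lt_mul_of_pos_left (h m hms x hx hxm) ha
  have h2 := mul_lt_mul_of_pos_left (h m hms y hy hym) hb
  rw [ex, inner_smul_right] at h1
  rw [ey, inner_smul_right, ← neg_sub x y, inner_neg_right] at h2
  have h3 : Φ m = a * Φ m + b * Φ m := by rw [← add_mul, hab, one_mul]
  simp only [smul_eq_mul]
  linarith

lemma convex_halfCylinder : Convex ℝ halfCylinder := by
  intro p hp q hq a b ha hb hab
  obtain ⟨hp1, hp2⟩ := hp
  obtain ⟨hq1, hq2⟩ := hq
  have eb : b = 1 - a := by linarith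
  refine ⟨?_, ?_⟩
  · simp only [PiLp.add_apply, PiLp.smul_apply, smul_eq_mul]
    have h1 := mul_le_mul_of_nonneg_left hp1 ha
    have h2 := mul_le_mul_of_nonneg_left hq1 hb
    have h3 := mul_nonneg (mul_nonneg ha hb) (add_nonneg (sq_nonneg (p 0 - q 0))
      (sq_nonneg (p 1 - q 1)))
    subst eb
    nlinarith
  · simp only [PiLp.add_apply, PiLp.smul_apply, smul_eq_mul]
    nlinarith

end StrictConvexity

/-! ### The function `f`, its gradient and its symmetry. -/

section BookFunction

lemma bookEquation_iff (p : E3) (a : ℝ) : BookEquation p a ↔ book (p 0) (p 1) (p 2) a = 0 :=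
  Iff.rfl

lemma book_injOn {x y z a a' : ℝ} (h : x ^ 2 + y ^ 2 ≤ (1 / 4) ^ 2) (ha : 1 ≤ a) (ha' : 1 ≤ a')
    (he : book x y z a = book x y z a') : a = a' := by
  rcases le_total a a' with hle | hle
  · have := (book_slope_bounds (z := z) h ha hle).1
    linarith
  · have := (book_slope_bounds (z := z) h ha' hle).1
    linarith

lemma exists_bookEquation {p : E3} (hp : p ∈ halfCylinder) : ∃ a, 1 ≤ a ∧ BookEquation p a := by
  obtain ⟨h, hz⟩ := hp
  have h1 : book (p 0) (p 1) (p 2) 1 ≤ 0 := by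
    have := logCosh_nonneg (1 * spineDist (p 0) (p 1) 1)
    unfold book
    have : 0 ≤ (p 0 ^ 2 + p 1 ^ 2) / (1 + 1) := by positivity
    linarith
  -- With slope at least `1/2`, the equation has become nonnegative at this level.
  set A := 1 - 2 * book (p 0) (p 1) (p 2) 1 with hA
  have h2 : 0 ≤ book (p 0) (p 1) (p 2) A := by
    have := (book_slope_bounds (z := p 2) h le_rfl (a := A) (by linarith)).1
    linarith
  obtain ⟨a, ha, he⟩ := intermediate_value_Icc (f := book (p 0) (p 1) (p 2)) (a := 1) (b := A)
    (by linarith) (fun u hu => (hasDerivAt_book _ _ _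
      (by linarith [hu.1])).continuousAt.continuousWithinAt) ⟨h1, h2⟩
  exact ⟨a, ha.1, he⟩

open Classical in
/-- The solution `f ≥ 1` of the book equation. -/
noncomputable def bookFun (p : E3) : ℝ :=
  if h : ∃ a, 1 ≤ a ∧ BookEquation p a then h.choose else 1

lemma bookFun_spec {p : E3} (hp : p ∈ halfCylinder) :
    1 ≤ bookFun p ∧ book (p 0) (p 1) (p 2) (bookFun p) = 0 := by
  have h := exists_bookEquation hp
  rw [bookFun, dif_pos h]
  exact h.choose_spec

lemma bookFun_eq {p : E3} (hp : p ∈ halfCylinder) {a : ℝ} (ha : 1 ≤ a)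
    (h : book (p 0) (p 1) (p 2) a = 0) : bookFun p = a :=
  book_injOn hp.1 (bookFun_spec hp).1 ha ((bookFun_spec hp).2.trans h.symm)

lemma isBookFunction_bookFun : IsBookFunction bookFun := fun p hp =>
  ⟨(bookFun_spec hp).1, fun a ha => ⟨fun h => (bookFun_eq hp ha h).symm, fun h => by
    rw [h, bookEquation_iff]; exact (bookFun_spec hp).2⟩⟩

lemma neg_le_bookFun {p : E3} (hp : p ∈ halfCylinder) : -p 2 ≤ bookFun p := by
  obtain ⟨h1, h2⟩ := bookFun_spec hp
  unfold book at h2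
  have := mul_nonneg (one_div_pos.2 (by linarith : 0 < bookFun p)).le
    (logCosh_nonneg (bookFun p * spineDist (p 0) (p 1) (bookFun p)))
  have : 0 ≤ (p 0 ^ 2 + p 1 ^ 2) / (1 + bookFun p) := by positivity
  linarith

/-- Slope at least `1/2` in `a` bounds `|f p - f p₀|` by `2 |book p (f p₀)|`, which is continuous in
`p` and vanishes at `p₀`. -/
lemma continuousOn_bookFun : ContinuousOn bookFun halfCylinder := by
  intro p₀ hp₀
  obtain ⟨h1, h2⟩ := bookFun_spec hp₀
  set a₀ := bookFun p₀
  have hc : Continuous fun p : E3 => 2 * |book (p 0) (p 1) (p 2) a₀| := by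
    have hl : Continuous logCosh :=
      continuous_iff_continuousAt.2 fun x => (hasDerivAt_logCosh x).continuousAt
    unfold book spineDist
    fun_prop
  have h0 : Filter.Tendsto (fun p : E3 => 2 * |book (p 0) (p 1) (p 2) a₀|)
      (nhdsWithin p₀ halfCylinder) (nhds 0) := by
    have := hc.tendsto p₀
    rw [h2, abs_zero, mul_zero] at this
    exact this.mono_left nhdsWithin_le_nhds
  refine tendsto_iff_dist_tendsto_zero.2 (squeeze_zero' (Filter.Eventually.of_forall
    fun _ => dist_nonneg) ?_ h0)
  filter_upwards [self_mem_nhdsWithin] with p hp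
  obtain ⟨g1, g2⟩ := bookFun_spec hp
  rw [Real.dist_eq]
  rcases le_total a₀ (bookFun p) with hle | hle
  · have := (book_slope_bounds (z := p 2) hp.1 h1 hle).1
    rw [abs_of_nonneg (sub_nonneg.2 hle)]
    linarith [neg_abs_le (book (p 0) (p 1) (p 2) a₀)]
  · have := (book_slope_bounds (z := p 2) hp.1 g1 hle).1
    rw [abs_of_nonpos (sub_nonpos.2 hle)]
    linarith [le_abs_self (book (p 0) (p 1) (p 2) a₀)]

/-- The derivative of the book equation in the point, as a vector. -/
noncomputable def bookNormal (x y a : ℝ) : E3 :=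
  !₂[-(Real.tanh (a * spineDist x y a) * Real.sin a) - 2 * x / (1 + a),
    Real.tanh (a * spineDist x y a) * Real.cos a - 2 * y / (1 + a), 1]

lemma inner_bookNormal (x y a : ℝ) (v : E3) :
    ⟪bookNormal x y a, v⟫ = bookSlope x y a (v 0) (v 1) (v 2) := by
  rw [inner_e3]
  simp [bookNormal, bookSlope, spineDist]
  ring

/-- The speed of the gradient flow of `height ∘ bookFun` along the axis. -/
noncomputable def levelSpeed (p : E3) : ℝ :=
  height (bookFun p) * heightRate (bookFun p) / bookDeriv (p 0) (p 1) (bookFun p)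

/-- The gradient of `height ∘ bookFun`. -/
noncomputable def levelGrad (p : E3) : E3 :=
  -(levelSpeed p • bookNormal (p 0) (p 1) (bookFun p))

lemma one_le_height (a : ℝ) : 1 ≤ height a := Real.one_le_exp (by positivity)

lemma levelSpeed_ge {p : E3} (hp : p ∈ halfCylinder) :
    height (bookFun p) * (1 + bookFun p) ≤ levelSpeed p := by
  obtain ⟨h1, -⟩ := bookFun_spec hp
  obtain ⟨h2, h3⟩ := bookDeriv_mem hp.1 h1
  unfold levelSpeed
  rw [mul_div_assoc]
  apply mul_le_mul_of_nonneg_left _ (height_pos _).le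
  rw [le_div_iff₀ (by linarith)]
  have := Real.add_one_le_exp (bookFun p)
  unfold heightRate
  nlinarith

lemma levelSpeed_pos {p : E3} (hp : p ∈ halfCylinder) : 0 < levelSpeed p :=
  lt_of_lt_of_le (mul_pos (height_pos _) (by linarith [(bookFun_spec hp).1])) (levelSpeed_ge hp)

/-- Gradients blow up downwards. This rules out finitely many pieces, and leaves finitely many
pieces above any given axial slope. -/
lemma neg_coord_le_levelSpeed {p : E3} (hp : p ∈ halfCylinder) : -p 2 ≤ levelSpeed p := by
  have h1 := neg_le_bookFun hp
  have h2 := levelSpeed_ge hp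
  have h3 := one_le_height (bookFun p)
  nlinarith [(bookFun_spec hp).1]

lemma levelGrad_two (p : E3) : levelGrad p 2 = -levelSpeed p := by
  simp [levelGrad, bookNormal]

lemma level_tangent_lt {p₀ p : E3} (h₀ : p₀ ∈ halfCylinder) (h : p ∈ halfCylinder)
    (hne : p ≠ p₀) :
    (height ∘ bookFun) p₀ + ⟪levelGrad p₀, p - p₀⟫ < (height ∘ bookFun) p := by
  obtain ⟨h1, h2⟩ := bookFun_spec h
  obtain ⟨g1, g2⟩ := bookFun_spec h₀
  have := height_tangent_lt h.1 h₀.1 h1 g1 h2 g2 (fun ⟨hx, hy, hz⟩ => hne (by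
    ext i; fin_cases i <;> assumption))
  rw [levelGrad, inner_neg_left, inner_smul_left, inner_bookNormal]
  exact this

lemma strictConvexOn_level : StrictConvexOn ℝ halfCylinder (height ∘ bookFun) :=
  strictConvexOn_of_tangent convex_halfCylinder fun _ h₀ _ h hne => level_tangent_lt h₀ h hne

/-- The rotation by a half turn about the axis. -/
noncomputable def halfTurn (p : E3) : E3 := !₂[-p 0, -p 1, p 2]

lemma halfTurn_mem {p : E3} (hp : p ∈ halfCylinder) : halfTurn p ∈ halfCylinder := by
  simpa [halfTurn, halfCylinder] using hp

lemma halfTurn_halfTurn (p : E3) : halfTurn (halfTurn p) = p := by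
  ext i; fin_cases i <;> simp [halfTurn]

lemma spineDist_neg (x y a : ℝ) : spineDist (-x) (-y) a = -spineDist x y a := by
  unfold spineDist; ring

lemma spineCoord_neg (x y a : ℝ) : spineCoord (-x) (-y) a = -spineCoord x y a := by
  unfold spineCoord; ring

/-- `log cosh` and `r²` are even. This symmetry is what makes the axis invariant for an unperturbed
trajectory. -/
lemma book_neg (x y z a : ℝ) : book (-x) (-y) z a = book x y z a := by
  unfold book
  rw [spineDist_neg, mul_neg, logCosh_neg, neg_sq, neg_sq]

lemma bookDeriv_neg (x y a : ℝ) : bookDeriv (-x) (-y) a = bookDeriv x y a := by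
  unfold bookDeriv
  rw [spineDist_neg, spineCoord_neg, mul_neg, logCosh_neg, Real.tanh_neg]
  ring

lemma bookFun_halfTurn {p : E3} (hp : p ∈ halfCylinder) : bookFun (halfTurn p) = bookFun p := by
  refine bookFun_eq (halfTurn_mem hp) (bookFun_spec hp).1 ?_
  have : book (halfTurn p 0) (halfTurn p 1) (halfTurn p 2) = book (-p 0) (-p 1) (p 2) := by
    simp [halfTurn]
  rw [this, book_neg]
  exact (bookFun_spec hp).2

lemma levelGrad_halfTurn {p : E3} (hp : p ∈ halfCylinder) :
    levelGrad (halfTurn p) = halfTurn (levelGrad p) := by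
  have h0 : halfTurn p 0 = -p 0 := by simp [halfTurn]
  have h1 : halfTurn p 1 = -p 1 := by simp [halfTurn]
  unfold levelGrad levelSpeed
  rw [bookFun_halfTurn hp, h0, h1, bookDeriv_neg]
  ext i
  fin_cases i <;> simp [halfTurn, bookNormal, spineDist_neg] <;> ring

lemma inner_halfTurn (g v : E3) : ⟪halfTurn g, halfTurn v⟫ = ⟪g, v⟫ := by
  rw [inner_e3, inner_e3]
  simp [halfTurn]

end BookFunction

/-! ### One steering step in the turning spine frame. -/

section Steering

lemma spineCoord_sub (x y α τ : ℝ) : spineCoord x y (α - τ)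
    = spineCoord x y α * Real.cos τ + spineDist x y α * Real.sin τ := by
  unfold spineCoord spineDist; rw [Real.cos_sub, Real.sin_sub]; ring

lemma spineDist_sub (x y α τ : ℝ) : spineDist x y (α - τ)
    = spineDist x y α * Real.cos τ - spineCoord x y α * Real.sin τ := by
  unfold spineCoord spineDist; rw [Real.cos_sub, Real.sin_sub]; ring

/-- The point of the level `a` with coordinates `ρ` along the spine and `s` across it. -/
noncomputable def bookPoint (a ρ s : ℝ) : E3 :=
  !₂[ρ * Real.cos a + s * Real.sin a, ρ * Real.sin a - s * Real.cos a,
    -a + 1 / a * logCosh (a * s) + (ρ ^ 2 + s ^ 2) / (1 + a)]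

lemma spineDist_bookPoint (a ρ s : ℝ) :
    spineDist (bookPoint a ρ s 0) (bookPoint a ρ s 1) a = s := by
  simp only [bookPoint, spineDist, PiLp.toLp_apply, Matrix.cons_val]
  linear_combination s * Real.sin_sq_add_cos_sq a

lemma spineCoord_bookPoint (a ρ s : ℝ) :
    spineCoord (bookPoint a ρ s 0) (bookPoint a ρ s 1) a = ρ := by
  simp only [bookPoint, spineCoord, PiLp.toLp_apply, Matrix.cons_val]
  linear_combination ρ * Real.sin_sq_add_cos_sq a

lemma bookPoint_sq_add_sq (a ρ s : ℝ) :
    bookPoint a ρ s 0 ^ 2 + bookPoint a ρ s 1 ^ 2 = ρ ^ 2 + s ^ 2 := by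
  rw [← spineDist_sq_add _ _ a, spineDist_bookPoint, spineCoord_bookPoint]; ring

lemma bookPoint_two (a ρ s : ℝ) : bookPoint a ρ s 2
    = -a + 1 / a * logCosh (a * s) + (ρ ^ 2 + s ^ 2) / (1 + a) := by
  simp [bookPoint]

lemma logCosh_div_le {a : ℝ} (ha : 0 < a) (s : ℝ) : 1 / a * logCosh (a * s) ≤ |s| := by
  have := logCosh_le_abs (a * s)
  rw [abs_mul, abs_of_pos ha] at this
  rw [one_div, inv_mul_le_iff₀ ha]
  exact this

variable {a ρ s : ℝ}

lemma bookPoint_mem (ha : 2 ≤ a) (h : ρ ^ 2 + s ^ 2 ≤ (1 / 4) ^ 2) :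
    bookPoint a ρ s ∈ halfCylinder := by
  refine ⟨(bookPoint_sq_add_sq a ρ s).le.trans h, ?_⟩
  rw [bookPoint_two]
  have h1 := logCosh_div_le (by linarith : 0 < a) s
  have h2 : |s| ≤ 1 / 4 := abs_le_of_sq_le_sq (by nlinarith [sq_nonneg ρ]) (by norm_num)
  have h3 : (ρ ^ 2 + s ^ 2) / (1 + a) ≤ ρ ^ 2 + s ^ 2 :=
    div_le_self (by positivity) (by linarith)
  linarith

lemma bookFun_bookPoint (ha : 2 ≤ a) (h : ρ ^ 2 + s ^ 2 ≤ (1 / 4) ^ 2) :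
    bookFun (bookPoint a ρ s) = a := by
  refine bookFun_eq (bookPoint_mem ha h) (by linarith) ?_
  unfold book
  rw [spineDist_bookPoint, bookPoint_sq_add_sq, bookPoint_two]
  ring

/-- The horizontal part of the drift at a point of the level `a`, in the spine frame of
angle `α`. -/
lemma spineCoord_bookNormal (x y a α : ℝ) :
    spineCoord (bookNormal x y a 0) (bookNormal x y a 1) α
      = -(Real.tanh (a * spineDist x y a) * Real.sin (a - α))
        - 2 / (1 + a) * spineCoord x y α := by
  simp only [bookNormal, spineCoord, PiLp.toLp_apply, Matrix.cons_val, Real.sin_sub]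
  ring

lemma spineDist_bookNormal (x y a α : ℝ) :
    spineDist (bookNormal x y a 0) (bookNormal x y a 1) α
      = -(Real.tanh (a * spineDist x y a) * Real.cos (a - α))
        - 2 / (1 + a) * spineDist x y α := by
  simp only [bookNormal, spineDist, PiLp.toLp_apply, Matrix.cons_val, Real.cos_sub]
  ring

variable {β τ η th c C : ℝ}

/-- The step climbs by `τ` from side `η`, with `th` the `tanh` factor and `c * C` the radial pull.
The tilted drift gains `τ * th * sin (β - η τ)`, at least `3/4 τ β`; turning the frame and the
radial pull cost only small multiples of `τ β`. -/
lemma steer_coord_bounds (hβ : 0 < β) (hβ1 : β ≤ 1 / 100) (hτ : τ = β / 16)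
    (hρ0 : 0 ≤ ρ) (hρ : ρ ≤ 1 / 8) (hs : |s| ≤ β / 8) (hη : η = 1 ∨ η = -1)
    (hth : 1 - β / 16 ≤ th) (hth1 : th ≤ 1) (hcC : |c * C| ≤ β / 16) :
    ρ + τ * β / 4 ≤ ρ * Real.cos τ + s * Real.sin τ
      + τ * (-(η * th * Real.sin (τ - η * β)) - c * C) ∧
    ρ * Real.cos τ + s * Real.sin τ + τ * (-(η * th * Real.sin (τ - η * β)) - c * C)
      ≤ ρ + 2 * τ * β := by
  have hτ0 : 0 < τ := by rw [hτ]; positivity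
  have hsin : η * Real.sin (τ - η * β) = -Real.sin (β - η * τ) := by
    rcases hη with rfl | rfl
    · rw [← Real.sin_neg]; ring_nf
    · rw [← neg_eq_neg_one_mul]; ring_nf
  have e : η * th * Real.sin (τ - η * β) = -(th * Real.sin (β - η * τ)) := by
    linear_combination th * hsin
  rw [e]
  set u := β - η * τ with hu
  have hu1 : 15 / 16 * β ≤ u ∧ u ≤ 17 / 16 * β := by
    rcases hη with rfl | rfl <;> constructor <;> linarith
  have hu0 : 0 < u := by linarith
  have h1 : 9 / 10 * u ≤ Real.sin u := by
    have := Real.sin_gt_sub_cube hu0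
    have h2 : u ^ 3 ≤ 1 / 10 * u := by
      have hu2 : u ^ 2 ≤ 1 / 10 := by nlinarith
      have := mul_le_mul_of_nonneg_right hu2 hu0.le
      linarith
    linarith
  have h2 : Real.sin u ≤ u := Real.sin_le hu0.le
  have h3 := Real.one_sub_sq_div_two_le_cos (x := τ)
  have h4 := Real.cos_le_one τ
  have h5 : |s * Real.sin τ| ≤ β / 8 * τ := by
    rw [abs_mul]
    have : |Real.sin τ| ≤ τ := by simpa [abs_of_pos hτ0] using Real.abs_sin_le_abs (x := τ)
    exact mul_le_mul hs this (abs_nonneg _) (by positivity)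
  have h6 := abs_le.1 h5
  have h7 := abs_le.1 hcC
  have h8 : 3 / 4 * β ≤ th * Real.sin u := by
    have : 99 / 100 ≤ th := by linarith
    have := mul_le_mul this h1 (by positivity) (by linarith)
    linarith
  have h9 : th * Real.sin u ≤ 17 / 16 * β := by nlinarith
  have h10 : ρ - τ ^ 2 / 16 ≤ ρ * Real.cos τ := by nlinarith
  have h11 : ρ * Real.cos τ ≤ ρ := by nlinarith
  have h12 := mul_le_mul_of_nonneg_left h8 hτ0.le
  have h13 := mul_le_mul_of_nonneg_left h9 hτ0.le
  have h14 := mul_le_mul_of_nonneg_left h7.1 hτ0.le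
  have h15 := mul_le_mul_of_nonneg_left h7.2 hτ0.le
  have h16 : τ ^ 2 = τ * β / 16 := by rw [sq]; nth_rewrite 2 [hτ]; ring
  have h17 : 0 < τ * β := by positivity
  constructor <;> linarith

/-- Measured from the side `η`, the drift moves the point towards the spine by between `τ / 2` and
`τ`. Turning the spine and the radial pull shift it by at most `τ / 8` each. So the distance does
not grow on that side, and the overshoot is at most `5 τ / 4 < β / 8`. -/
lemma steer_dist_bound (hβ : 0 < β) (hβ1 : β ≤ 1 / 100) (hτ : τ = β / 16)
    (hρ0 : 0 ≤ ρ) (hρ : ρ ≤ 1 / 8) (hs : |s| ≤ β / 8) (hη : η = 1 ∨ η = -1) (hηs : 0 ≤ η * s)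
    (hth : 1 - β / 16 ≤ th) (hth1 : th ≤ 1) (hcC : |c * C| ≤ β / 16) :
    |s * Real.cos τ - ρ * Real.sin τ + τ * (-(η * th * Real.cos (τ - η * β)) - c * C)|
      ≤ β / 8 := by
  have hτ0 : 0 < τ := by rw [hτ]; positivity
  have hη1 : |η| = 1 := by rcases hη with rfl | rfl <;> simp
  have hη2 : η * η = 1 := by rcases hη with rfl | rfl <;> norm_num
  rw [← one_mul |_|, ← hη1, ← abs_mul]
  have hsin : |ρ * Real.sin τ| ≤ τ / 8 := by
    rw [abs_mul, abs_of_nonneg hρ0]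
    have : |Real.sin τ| ≤ τ := by simpa [abs_of_pos hτ0] using Real.abs_sin_le_abs (x := τ)
    nlinarith [abs_nonneg (Real.sin τ)]
  have e : η * (s * Real.cos τ - ρ * Real.sin τ
      + τ * (-(η * th * Real.cos (τ - η * β)) - c * C))
      = η * s * Real.cos τ - η * (ρ * Real.sin τ) - τ * (th * Real.cos (τ - η * β))
        - τ * (η * (c * C)) := by linear_combination (-τ * th * Real.cos (τ - η * β)) * hη2
  rw [e]
  have h1 := abs_le.1 (show |η * (ρ * Real.sin τ)| ≤ τ / 8 by rwa [abs_mul, hη1, one_mul])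
  have h2 := abs_le.1 (show |η * (c * C)| ≤ β / 16 by rwa [abs_mul, hη1, one_mul])
  have h3 : η * s ≤ β / 8 := by
    rw [← abs_of_nonneg hηs, abs_mul, hη1, one_mul]; exact hs
  have h4 : |τ - η * β| ≤ 2 * β := by
    rw [abs_le]; rcases hη with rfl | rfl <;> constructor <;> linarith
  have h5 : 99 / 100 ≤ Real.cos (τ - η * β) := by
    have h51 := Real.one_sub_sq_div_two_le_cos (x := τ - η * β)
    have h52 : (τ - η * β) ^ 2 ≤ (2 * β) ^ 2 := sq_le_sq' (abs_le.1 h4).1 (abs_le.1 h4).2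
    nlinarith
  have h6 := Real.cos_le_one (τ - η * β)
  have hth0 : 99 / 100 ≤ th := by linarith
  have h7 : 1 / 2 ≤ th * Real.cos (τ - η * β) := by nlinarith
  have h8 : th * Real.cos (τ - η * β) ≤ 1 := by nlinarith
  have h9 := Real.cos_le_one τ
  have h10 : 0 ≤ Real.cos τ := by
    have := Real.one_sub_sq_div_two_le_cos (x := τ)
    nlinarith
  have h11 : 0 ≤ η * s * Real.cos τ := mul_nonneg hηs h10
  have h12 : η * s * Real.cos τ ≤ η * s := mul_le_of_le_one_right hηs h9
  have h13 := mul_le_mul_of_nonneg_left h7 hτ0.le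
  have h14 := mul_le_mul_of_nonneg_left h8 hτ0.le
  have h15 := mul_le_mul_of_nonneg_left h2.1 hτ0.le
  have h16 := mul_le_mul_of_nonneg_left h2.2 hτ0.le
  have h17 : τ * (β / 16) ≤ τ / 8 := by nlinarith
  rw [abs_le]
  constructor <;> linarith

end Steering

/-! ### The control law and its invariants. -/

section Control

/-- The spine coordinate of a point, at the spine angle of its height. -/
noncomputable def alongSpine (w : E3) : ℝ := spineCoord (w 0) (w 1) (-w 2)

/-- The distance of a point to the spine of its height. -/
noncomputable def acrossSpine (w : E3) : ℝ := spineDist (w 0) (w 1) (-w 2)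

/-- The side of the spine on which a point lies. -/
noncomputable def spineSide (w : E3) : ℝ := if 0 ≤ acrossSpine w then 1 else -1

/-- The level steered at from `w`. -/
noncomputable def controlLevel (β : ℝ) (w : E3) : ℝ := -w 2 - spineSide w * β

/-- The point near `w`, on the same side of the spine, whose drift is used at `w`. -/
noncomputable def controlPoint (β : ℝ) (w : E3) : E3 :=
  bookPoint (controlLevel β w) (spineCoord (w 0) (w 1) (controlLevel β w))
    (spineSide w * (β / 8))

/-- The drift direction at the control point. -/
noncomputable def controlDrift (β : ℝ) (w : E3) : E3 :=
  bookNormal (controlPoint β w 0) (controlPoint β w 1) (controlLevel β w)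

/-- One step of steering. -/
noncomputable def steer (β : ℝ) (w : E3) : E3 := w + (β / 16) • controlDrift β w

/-- The points from which steering is possible. -/
structure Steerable (β : ℝ) (w : E3) : Prop where
  beta_pos : 0 < β
  beta_le : β ≤ 1 / 100
  height_le : 128 / β ^ 2 + 3 ≤ -w 2
  along_nonneg : 0 ≤ alongSpine w
  along_le : alongSpine w ≤ 1 / 8
  across_le : |acrossSpine w| ≤ β / 8

lemma spineSide_eq (w : E3) : spineSide w = 1 ∨ spineSide w = -1 := by
  unfold spineSide; split_ifs <;> simp

lemma spineSide_mul_nonneg (w : E3) : 0 ≤ spineSide w * acrossSpine w := by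
  unfold spineSide; split_ifs with h <;> linarith

lemma tanh_mul_of_sign {η : ℝ} (hη : η = 1 ∨ η = -1) (a k : ℝ) :
    Real.tanh (a * (η * k)) = η * Real.tanh (a * k) := by
  rcases hη with rfl | rfl
  · simp
  · simp [Real.tanh_neg]

lemma abs_spineDist_le_add (x y a : ℝ) : |spineDist x y a| ≤ |x| + |y| := by
  unfold spineDist
  refine (abs_sub _ _).trans ?_
  rw [abs_mul, abs_mul]
  exact add_le_add (mul_le_of_le_one_right (abs_nonneg _) (Real.abs_sin_le_one a))
    (mul_le_of_le_one_right (abs_nonneg _) (Real.abs_cos_le_one a))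

variable {β : ℝ} {w : E3}

namespace Steerable

lemma level_ge (h : Steerable β w) : 128 / β ^ 2 + 2 ≤ controlLevel β w := by
  have h1 := h.height_le
  have h2 := h.beta_pos
  have h3 := h.beta_le
  unfold controlLevel
  rcases spineSide_eq w with e | e <;> rw [e] <;> linarith

lemma two_le_level (h : Steerable β w) : 2 ≤ controlLevel β w := by
  have := h.level_ge
  have : 0 ≤ 128 / β ^ 2 := by positivity
  linarith

lemma two_div_level_le (h : Steerable β w) : 2 / (1 + controlLevel β w) ≤ β / 16 := by
  have h1 := h.level_ge
  have h2 := h.beta_pos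
  have h3 := h.beta_le
  rw [div_le_iff₀ (by linarith [h.two_le_level])]
  have h4 : β * (128 / β ^ 2) = 128 / β := by field_simp
  have h5 : 1 ≤ 1 / β := by rw [le_div_iff₀ h2]; linarith
  have h6 : (128 : ℝ) / β = 128 * (1 / β) := by ring
  nlinarith

/-- The depth `128 / β ^ 2` is calibrated here: at distance `β / 8` from the spine the defect of
`tanh` is at most `8 / (a β) ≤ β / 16`. -/
lemma tanh_ge (h : Steerable β w) :
    1 - β / 16 ≤ Real.tanh (controlLevel β w * (β / 8)) := by
  have h1 := h.level_ge
  have h2 := h.beta_pos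
  have h3 := h.two_le_level
  have h4 := one_sub_tanh_le (x := controlLevel β w * (β / 8)) (by positivity)
  have h5 : 1 / (controlLevel β w * (β / 8)) ≤ β / 16 := by
    rw [div_le_iff₀ (by positivity)]
    have h6 : 128 / β ^ 2 * β ^ 2 = 128 := by field_simp
    nlinarith
  linarith

lemma coord_mem (h : Steerable β w) :
    |spineCoord (w 0) (w 1) (controlLevel β w)| ≤ 1 / 7 ∧
    |spineDist (w 0) (w 1) (controlLevel β w)| ≤ β / 4 := by
  have h1 := spineCoord_sub (w 0) (w 1) (-w 2) (spineSide w * β)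
  have h2 := spineDist_sub (w 0) (w 1) (-w 2) (spineSide w * β)
  have hρ : |alongSpine w| ≤ 1 / 8 := by rw [abs_of_nonneg h.along_nonneg]; exact h.along_le
  have hs := h.across_le
  have hβ := h.beta_pos
  have hc := Real.abs_cos_le_one (spineSide w * β)
  have hsn : |Real.sin (spineSide w * β)| ≤ β := by
    refine (Real.abs_sin_le_abs).trans ?_
    rcases spineSide_eq w with e | e <;> rw [e] <;> simp [abs_of_pos hβ]
  have hb := h.beta_le
  unfold controlLevel
  rw [h1, h2]
  change |alongSpine w * _ + acrossSpine w * _| ≤ _ ∧ |acrossSpine w * _ - alongSpine w * _| ≤ _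
  have g1 := mul_le_mul hρ hc (abs_nonneg _) (by norm_num)
  have g2 := mul_le_mul hs hsn (abs_nonneg _) (by positivity)
  have g3 := mul_le_mul hs hc (abs_nonneg _) (by positivity)
  have g4 := mul_le_mul hρ hsn (abs_nonneg _) (by norm_num)
  rw [← abs_mul] at g1 g2 g3 g4
  constructor
  · refine (abs_add_le _ _).trans ?_
    nlinarith
  · refine (abs_sub _ _).trans ?_
    linarith

lemma abs_side (_ : Steerable β w) : |spineSide w| = 1 := by
  rcases spineSide_eq w with e | e <;> rw [e] <;> simp

lemma radius_le (h : Steerable β w) :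
    spineCoord (w 0) (w 1) (controlLevel β w) ^ 2 + (spineSide w * (β / 8)) ^ 2
      ≤ (1 / 4) ^ 2 := by
  have h1 := sq_le_sq' (abs_le.1 h.coord_mem.1).1 (abs_le.1 h.coord_mem.1).2
  have h2 : spineSide w ^ 2 = 1 := by rw [← sq_abs, h.abs_side, one_pow]
  have h3 := h.beta_pos
  have h4 := h.beta_le
  rw [mul_pow, h2]
  nlinarith

lemma controlPoint_mem (h : Steerable β w) : controlPoint β w ∈ halfCylinder :=
  bookPoint_mem h.two_le_level h.radius_le

lemma bookFun_controlPoint (h : Steerable β w) :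
    bookFun (controlPoint β w) = controlLevel β w :=
  bookFun_bookPoint h.two_le_level h.radius_le

lemma controlPoint_two (h : Steerable β w) : |controlPoint β w 2 - w 2| ≤ 5 / 4 * β := by
  have h1 : controlPoint β w 2 = _ := bookPoint_two _ _ _
  have ha : 0 < controlLevel β w := by linarith [h.two_le_level]
  have h2 := logCosh_div_le ha (spineSide w * (β / 8))
  have hβ := h.beta_pos
  rw [abs_mul, h.abs_side, one_mul, abs_of_pos (by positivity)] at h2
  have h3 := mul_nonneg (one_div_pos.2 ha).le
    (logCosh_nonneg (controlLevel β w * (spineSide w * (β / 8))))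
  have h4 := h.radius_le
  have h5 := h.two_div_level_le
  set R := spineCoord (w 0) (w 1) (controlLevel β w) ^ 2 + (spineSide w * (β / 8)) ^ 2 with hR
  have hR0 : 0 ≤ R := by positivity
  have h6 : R / (1 + controlLevel β w) ≤ β / 16 := by
    refine le_trans ?_ h5
    gcongr
    linarith
  have h7 : 0 ≤ R / (1 + controlLevel β w) := by positivity
  have h8 : w 2 = -controlLevel β w - spineSide w * β := by unfold controlLevel; ring
  have h9 : |spineSide w * β| ≤ β := by rw [abs_mul, h.abs_side, one_mul, abs_of_pos hβ]
  have h10 := abs_le.1 h9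
  rw [h1, h8, abs_le]
  constructor <;> linarith

/-- In the frame of the control level, `w` and its control point share the coordinate along the
spine, so they differ horizontally only across it. -/
lemma controlPoint_horizontal (h : Steerable β w) :
    |controlPoint β w 0 - w 0| ≤ 3 / 8 * β ∧ |controlPoint β w 1 - w 1| ≤ 3 / 8 * β := by
  set a := controlLevel β w with ha
  set e := spineSide w * (β / 8) - spineDist (w 0) (w 1) a with he
  have hβ := h.beta_pos
  have h1 : |e| ≤ 3 / 8 * β := by
    refine (abs_sub _ _).trans ?_
    rw [abs_mul, h.abs_side, one_mul, abs_of_pos (by positivity)]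
    linarith [h.coord_mem.2]
  have e0 : controlPoint β w 0 - w 0 = e * Real.sin a := by
    simp only [controlPoint, bookPoint, PiLp.toLp_apply, Matrix.cons_val, he]
    unfold spineDist spineCoord
    linear_combination (w 0) * Real.sin_sq_add_cos_sq a
  have e1 : controlPoint β w 1 - w 1 = -(e * Real.cos a) := by
    simp only [controlPoint, bookPoint, PiLp.toLp_apply, Matrix.cons_val, he]
    unfold spineDist spineCoord
    linear_combination (w 1) * Real.sin_sq_add_cos_sq a
  rw [e0, e1, abs_neg, abs_mul, abs_mul]
  exact ⟨(mul_le_of_le_one_right (abs_nonneg _) (Real.abs_sin_le_one a)).trans h1,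
    (mul_le_of_le_one_right (abs_nonneg _) (Real.abs_cos_le_one a)).trans h1⟩

lemma norm_controlPoint_sub (h : Steerable β w) : ‖controlPoint β w - w‖ ≤ 3 * β := by
  have hβ := h.beta_pos
  have : ‖controlPoint β w - w‖ ≤ 2 * (5 / 4 * β) := by
    refine norm_le_of_coord_le fun i => ?_
    fin_cases i
    · exact h.controlPoint_horizontal.1.trans (by linarith)
    · exact h.controlPoint_horizontal.2.trans (by linarith)
    · exact h.controlPoint_two
  linarith

lemma abs_coord_le (h : Steerable β w) :
    |controlPoint β w 0| ≤ 1 / 4 ∧ |controlPoint β w 1| ≤ 1 / 4 := by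
  have := h.controlPoint_mem.1
  exact ⟨abs_le_of_sq_le_sq (by nlinarith [sq_nonneg (controlPoint β w 1)]) (by norm_num),
    abs_le_of_sq_le_sq (by nlinarith [sq_nonneg (controlPoint β w 0)]) (by norm_num)⟩

lemma abs_drift_le (h : Steerable β w) (i : Fin 3) : |controlDrift β w i| ≤ 2 := by
  obtain ⟨h1, h2⟩ := h.abs_coord_le
  have ha := h.two_le_level
  set a := controlLevel β w with had
  have key : ∀ T f q : ℝ, |T| ≤ 1 → |f| ≤ 1 → |q| ≤ 1 / 4 → |T * f - 2 * q / (1 + a)| ≤ 2 := by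
    intro T f q hT hf hq
    refine (abs_sub _ _).trans ?_
    rw [abs_mul, abs_div, abs_mul, abs_of_pos (by linarith : 0 < 1 + a), abs_two]
    have g1 := mul_le_mul hT hf (abs_nonneg _) zero_le_one
    have g2 : 2 * |q| / (1 + a) ≤ 1 := by rw [div_le_iff₀ (by linarith)]; linarith
    linarith
  have hT := abs_tanh_le_one (a * spineDist (controlPoint β w 0) (controlPoint β w 1) a)
  fin_cases i
  · have := key _ (-Real.sin a) _ hT (by rw [abs_neg]; exact Real.abs_sin_le_one a) h1
    rw [mul_neg] at this
    exact this
  · exact key _ _ _ hT (Real.abs_cos_le_one a) h2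
  · simp [controlDrift, bookNormal]

lemma norm_controlPoint_sub_steer (h : Steerable β w) :
    ‖controlPoint β w - steer β w‖ ≤ 3 * β := by
  have hβ := h.beta_pos
  have : ‖controlPoint β w - steer β w‖ ≤ 2 * (11 / 8 * β) := by
    refine norm_le_of_coord_le fun i => ?_
    have h1 : |controlPoint β w i - w i| ≤ 5 / 4 * β := by
      fin_cases i
      · exact h.controlPoint_horizontal.1.trans (by linarith)
      · exact h.controlPoint_horizontal.2.trans (by linarith)
      · exact h.controlPoint_two
    have h2 := h.abs_drift_le i
    have e : (controlPoint β w - steer β w) i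
        = (controlPoint β w i - w i) - β / 16 * controlDrift β w i := by
      simp [steer]; ring
    rw [e]
    refine (abs_sub _ _).trans ?_
    rw [abs_mul, abs_of_pos (by positivity : 0 < β / 16)]
    nlinarith
  linarith

lemma steer_two (_ : Steerable β w) : steer β w 2 = w 2 + β / 16 := by
  simp [steer, controlDrift, bookNormal]

lemma spineDist_controlPoint (_ : Steerable β w) :
    spineDist (controlPoint β w 0) (controlPoint β w 1) (controlLevel β w)
      = spineSide w * (β / 8) := spineDist_bookPoint _ _ _

/-- In the spine frame of the new height, turned by `τ`, the control level sits at angle `τ - η β`;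
this reduces the claim to `steer_coord_bounds` and `steer_dist_bound`. -/
lemma steer_bounds (h : Steerable β w) :
    alongSpine w + β / 16 * β / 4 ≤ alongSpine (steer β w) ∧
    alongSpine (steer β w) ≤ alongSpine w + 2 * (β / 16) * β ∧
    |acrossSpine (steer β w)| ≤ β / 8 := by
  have hβ := h.beta_pos
  obtain ⟨h1, h2⟩ := h.abs_coord_le
  have ha := h.two_le_level
  have hη := spineSide_eq w
  set α := -w 2 with hα
  set τ := β / 16 with hτ
  set η := spineSide w with hηd
  set T := Real.tanh (controlLevel β w * (β / 8)) with hT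
  have eα : -(steer β w 2) = α - τ := by rw [h.steer_two]; ring
  have el : controlLevel β w - (α - τ) = τ - η * β := by unfold controlLevel; ring
  have e1 : alongSpine (steer β w) = alongSpine w * Real.cos τ + acrossSpine w * Real.sin τ
      + τ * (-(η * T * Real.sin (τ - η * β)) - 2 / (1 + controlLevel β w)
        * spineCoord (controlPoint β w 0) (controlPoint β w 1) (α - τ)) := by
    have g : alongSpine (steer β w) = spineCoord (w 0) (w 1) (α - τ)
        + τ * spineCoord (controlDrift β w 0) (controlDrift β w 1) (α - τ) := by
      unfold alongSpine
      rw [eα]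
      simp only [steer, spineCoord, PiLp.add_apply, PiLp.smul_apply, smul_eq_mul]
      ring
    rw [g, spineCoord_sub, controlDrift, spineCoord_bookNormal, h.spineDist_controlPoint,
      tanh_mul_of_sign hη, el]
    rfl
  have e2 : acrossSpine (steer β w) = acrossSpine w * Real.cos τ - alongSpine w * Real.sin τ
      + τ * (-(η * T * Real.cos (τ - η * β)) - 2 / (1 + controlLevel β w)
        * spineDist (controlPoint β w 0) (controlPoint β w 1) (α - τ)) := by
    have g : acrossSpine (steer β w) = spineDist (w 0) (w 1) (α - τ)
        + τ * spineDist (controlDrift β w 0) (controlDrift β w 1) (α - τ) := by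
      unfold acrossSpine
      rw [eα]
      simp only [steer, spineDist, PiLp.add_apply, PiLp.smul_apply, smul_eq_mul]
      ring
    rw [g, spineDist_sub, controlDrift, spineDist_bookNormal, h.spineDist_controlPoint,
      tanh_mul_of_sign hη, el]
    rfl
  have hc0 : 0 ≤ 2 / (1 + controlLevel β w) := by positivity
  have hcC : ∀ C : ℝ, |C| ≤ 1 / 4 → |2 / (1 + controlLevel β w) * C| ≤ β / 16 := by
    intro C hC
    rw [abs_mul, abs_of_nonneg hc0]
    exact (mul_le_of_le_one_right hc0 (by linarith)).trans h.two_div_level_le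
  have hC1 := hcC _ (abs_spineCoord_le (a := α - τ) h.controlPoint_mem.1)
  have hC2 := hcC _ (abs_spineDist_le (a := α - τ) h.controlPoint_mem.1)
  have hT1 : T ≤ 1 := (Real.tanh_lt_one _).le
  have b1 := steer_coord_bounds hβ h.beta_le hτ h.along_nonneg h.along_le h.across_le hη
    h.tanh_ge hT1 hC1
  have b2 := steer_dist_bound hβ h.beta_le hτ h.along_nonneg h.along_le h.across_le hη
    (spineSide_mul_nonneg w) h.tanh_ge hT1 hC2
  rw [e1, e2]
  exact ⟨b1.1, b1.2, b2⟩

end Steerable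

end Control

/-! ### Iterated steering away from the axis. -/

section ControlSequence

lemma axisPoint_apply (z : ℝ) : axisPoint z 0 = 0 ∧ axisPoint z 1 = 0 ∧ axisPoint z 2 = z := by
  simp [axisPoint]

lemma axisPoint_mem {z : ℝ} (hz : z ≤ -1) : axisPoint z ∈ halfCylinder := by
  obtain ⟨h0, h1, h2⟩ := axisPoint_apply z
  refine ⟨?_, by rw [h2]; exact hz⟩
  rw [h0, h1]; norm_num

lemma bookNormal_zero (a : ℝ) : bookNormal 0 0 a = axisPoint 1 := by
  have : spineDist 0 0 a = 0 := by unfold spineDist; ring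
  ext i
  fin_cases i <;> simp [bookNormal, axisPoint, this]

lemma spineCoord_le_norm (v : E3) (α : ℝ) : spineCoord (v 0) (v 1) α ≤ ‖v‖ := by
  rw [EuclideanSpace.norm_eq]
  apply Real.le_sqrt_of_sq_le
  simp only [Fin.sum_univ_three, Real.norm_eq_abs, sq_abs]
  have := spineDist_sq_add (v 0) (v 1) α
  nlinarith [sq_nonneg (spineDist (v 0) (v 1) α), sq_nonneg (v 2)]

lemma neg_levelGrad (p : E3) : -levelGrad p
    = levelSpeed p • bookNormal (p 0) (p 1) (bookFun p) := by
  rw [levelGrad, neg_neg]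

/-- The invariants of the steered path that starts on the axis at height `-A`. -/
lemma steer_iterate_bounds {β A L : ℝ} (hβ : 0 < β) (hβ1 : β ≤ 1 / 100)
    (hA : 128 / β ^ 2 + 3 + L ≤ A) (hL : 2 * L * β ≤ 1 / 8) (k : ℕ) (hk : k * (β / 16) ≤ L) :
    Steerable β ((steer β)^[k] (axisPoint (-A))) ∧
    (steer β)^[k] (axisPoint (-A)) 2 = -A + k * (β / 16) ∧
    k * (β / 16) * β / 4 ≤ alongSpine ((steer β)^[k] (axisPoint (-A))) ∧
    alongSpine ((steer β)^[k] (axisPoint (-A))) ≤ 2 * (k * (β / 16)) * β := by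
  induction k with
  | zero =>
    obtain ⟨h0, h1, h2⟩ := axisPoint_apply (-A)
    simp only [Nat.cast_zero, zero_mul] at hk
    have ha : alongSpine (axisPoint (-A)) = 0 := by
      unfold alongSpine spineCoord; rw [h0, h1]; ring
    have hs : acrossSpine (axisPoint (-A)) = 0 := by
      unfold acrossSpine spineDist; rw [h0, h1]; ring
    simp only [Function.iterate_zero, id]
    refine ⟨⟨hβ, hβ1, by rw [h2]; linarith, ha.ge, by rw [ha]; norm_num, ?_⟩, by rw [h2]; simp,
      by rw [ha]; simp, by rw [ha]; simp⟩
    rw [hs, abs_zero]; positivity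
  | succ k ih =>
    push_cast at hk
    obtain ⟨hS, h2, h3, h4⟩ := ih (by nlinarith)
    rw [Function.iterate_succ', Function.comp_apply]
    set w := (steer β)^[k] (axisPoint (-A))
    obtain ⟨b1, b2, b3⟩ := hS.steer_bounds
    have g2 : steer β w 2 = -A + ((k + 1 : ℕ) : ℝ) * (β / 16) := by
      rw [hS.steer_two, h2]; push_cast; ring
    have g4 : alongSpine (steer β w) ≤ 2 * (((k + 1 : ℕ) : ℝ) * (β / 16)) * β := by
      push_cast; linarith
    refine ⟨⟨hβ, hβ1, ?_, ?_, ?_, b3⟩, g2, by push_cast; linarith, g4⟩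
    · rw [g2]; push_cast; linarith
    · have := hS.along_nonneg
      have : 0 ≤ β / 16 * β / 4 := by positivity
      linarith
    · push_cast at g4
      nlinarith

/-- For each `N`, finitely many points below the height `-N` carry drifts that steer a path from
the axis to a distance of the axis more than `N` times its distance to the points. -/
lemma exists_control_sequence (N : ℕ) (hN : 1 ≤ N) :
    ∃ (K : ℕ) (p w : ℕ → E3) (d : ℕ → ℝ) (ε z : ℝ), 0 < ε ∧ p 0 = axisPoint z ∧
      w 0 = axisPoint z ∧ (∀ k ≤ K, p k ∈ halfCylinder ∧ p k 2 ≤ -N) ∧ (∀ k < K, 0 < d k) ∧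
      (∀ k < K, w (k + 1) = w k + d k • -levelGrad (p k)) ∧ (∀ k ≤ K, ‖p k - w k‖ ≤ ε) ∧
      (∀ k < K, ‖p k - w (k + 1)‖ ≤ ε) ∧ ∀ z', N * ε < ‖p K - axisPoint z'‖ := by
  have hN' : (1 : ℝ) ≤ N := by exact_mod_cast hN
  -- With `L = 100 N` the outward displacement is at most `2 L β = 1/8`, as steerability requires,
  -- and at least `L β / 4 = 25 β N`, which exceeds `3 β N + 3 β`.
  set β : ℝ := 1 / (1600 * N) with hβd
  have hβN : β * N = 1 / 1600 := by rw [hβd]; field_simp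
  have hβ : 0 < β := by positivity
  have hβ1 : β ≤ 1 / 100 := by nlinarith
  set L : ℝ := 100 * N with hL
  -- Deep enough to remain steerable and below `-N` after a climb by `L`.
  set A : ℝ := 128 / β ^ 2 + 3 + L + N + 10 with hA
  have hq : 0 ≤ 128 / β ^ 2 := by positivity
  set M : ℕ := 100 * N * (25600 * N) with hM
  have hMτ : (M : ℝ) * (β / 16) = L := by
    rw [hM]; push_cast
    linear_combination (160000 * N : ℝ) * hβN
  have hinv : ∀ k ≤ M, _ := fun k hk => steer_iterate_bounds (A := A) (L := L) hβ hβ1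
    (by linarith) (by nlinarith) k (by
      rw [← hMτ]
      have : (k : ℝ) ≤ M := by exact_mod_cast hk
      gcongr)
  set W : ℕ → E3 := fun k => (steer β)^[k] (axisPoint (-A)) with hW
  -- Control points lie off the axis. One vertical leg is put in front so that both `p` and `w`
  -- start on it, at the same point.
  set z₀ : ℝ := -A - β / 16 with hz₀
  set p : ℕ → E3 := fun k => Nat.rec (axisPoint z₀) (fun k _ => controlPoint β (W k)) k with hp
  set w : ℕ → E3 := fun k => Nat.rec (axisPoint z₀) (fun k _ => W k) k with hw
  have hz₀m : axisPoint z₀ ∈ halfCylinder := axisPoint_mem (by linarith)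
  have hlow : ∀ k ≤ M + 1, p k ∈ halfCylinder ∧ p k 2 ≤ -N := by
    rintro (_ | k) hk
    · refine ⟨hz₀m, ?_⟩
      change axisPoint z₀ 2 ≤ -N
      rw [(axisPoint_apply z₀).2.2]
      linarith
    · obtain ⟨hS, h2, -, -⟩ := hinv k (by omega)
      refine ⟨hS.controlPoint_mem, ?_⟩
      have h3 := (abs_le.1 hS.controlPoint_two).2
      have h4 : (k : ℝ) * (β / 16) ≤ L := by
        rw [← hMτ]
        have : (k : ℝ) ≤ M := by exact_mod_cast (by omega : k ≤ M)
        gcongr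
      change controlPoint β (W k) 2 ≤ -N
      linarith
  -- The drift has vertical component `levelSpeed`, so this duration makes every leg climb by `β /
  -- 16`.
  have hd : ∀ k < M + 1, 0 < β / 16 / levelSpeed (p k) := fun k hk =>
    div_pos (by positivity) (levelSpeed_pos (hlow k hk.le).1)
  have hnear : ∀ k ≤ M + 1, ‖p k - w k‖ ≤ 3 * β := by
    rintro (_ | k) hk
    · change ‖axisPoint z₀ - axisPoint z₀‖ ≤ 3 * β
      rw [sub_self, norm_zero]; positivity
    · exact (hinv k (by omega)).1.norm_controlPoint_sub
  have hstep : ∀ k < M + 1, w (k + 1) = w k + (β / 16) •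
      bookNormal (p k 0) (p k 1) (bookFun (p k)) := by
    rintro (_ | k) hk
    · change axisPoint (-A) = axisPoint z₀ + (β / 16) •
        bookNormal (axisPoint z₀ 0) (axisPoint z₀ 1) _
      obtain ⟨h0, h1, -⟩ := axisPoint_apply z₀
      rw [h0, h1, bookNormal_zero, axisPoint_add_smul, hz₀]
      ring_nf
    · have hS := (hinv k (by omega)).1
      change W (k + 1) = W k + (β / 16) • bookNormal (controlPoint β (W k) 0)
        (controlPoint β (W k) 1) (bookFun (controlPoint β (W k)))
      rw [hS.bookFun_controlPoint]
      exact Function.iterate_succ_apply' (steer β) k (axisPoint (-A))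
  refine ⟨M + 1, p, w, fun k => β / 16 / levelSpeed (p k), 3 * β, z₀, by positivity, rfl, rfl,
    hlow, hd, ?_, hnear, ?_, ?_⟩
  · intro k hk
    rw [neg_levelGrad, smul_smul, div_mul_cancel₀ _ (levelSpeed_pos (hlow k hk.le).1).ne']
    exact hstep k hk
  · rintro (_ | k) hk
    · change ‖axisPoint z₀ - axisPoint (-A)‖ ≤ 3 * β
      have : axisPoint (-A) = axisPoint z₀ + (β / 16) • axisPoint 1 := by
        rw [axisPoint_add_smul, hz₀]; ring_nf
      rw [this, sub_add_cancel_left, norm_neg, norm_smul, Real.norm_of_nonneg (by positivity),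
        axisPoint, PiLp.norm_single, norm_one]
      linarith
    · have hS := (hinv k (by omega)).1
      have e : w (k + 1 + 1) = steer β (W k) :=
        Function.iterate_succ_apply' (steer β) k (axisPoint (-A))
      rw [e]
      exact hS.norm_controlPoint_sub_steer
  · intro z'
    obtain ⟨-, -, h3, -⟩ := hinv M le_rfl
    have h4 := spineCoord_le_norm (W M - axisPoint z') (-(W M 2))
    obtain ⟨g0, g1, -⟩ := axisPoint_apply z'
    rw [PiLp.sub_apply, PiLp.sub_apply, g0, g1, sub_zero, sub_zero] at h4
    have h5 := hnear (M + 1) le_rfl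
    have h6 : ‖W M - axisPoint z'‖ ≤ ‖p (M + 1) - W M‖ + ‖p (M + 1) - axisPoint z'‖ := by
      rw [norm_sub_rev (p (M + 1)) (W M)]
      exact norm_sub_le_norm_sub_add_norm_sub _ _ _
    rw [hMτ] at h3
    have h7 : L * β / 4 ≤ spineCoord (W M 0) (W M 1) (-(W M 2)) := h3
    have h8 : ‖p (M + 1) - W M‖ ≤ 3 * β := h5
    have h9 : L * β = 100 * (β * N) := by rw [hL]; ring
    have h10 : N * (3 * β) = 3 * (β * N) := by ring
    have h11 : β ≤ β * N := by nlinarith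
    rw [h10]
    linarith

end ControlSequence

/-! ### Finite tangent nets on slabs. -/

section Nets

/-- The tangent function of `height ∘ bookFun` at `q`. -/
noncomputable def levelTangent (q p : E3) : ℝ :=
  ⟪levelGrad q, p⟫ + ((height ∘ bookFun) q - ⟪levelGrad q, q⟫)

lemma levelTangent_self (q : E3) : levelTangent q q = (height ∘ bookFun) q := by
  unfold levelTangent; ring

lemma levelTangent_eq (q p : E3) :
    levelTangent q p = (height ∘ bookFun) q + ⟪levelGrad q, p - q⟫ := by
  unfold levelTangent; rw [inner_sub_right]; ring

lemma levelTangent_le {q p : E3} (hq : q ∈ halfCylinder) (hp : p ∈ halfCylinder) :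
    levelTangent q p ≤ (height ∘ bookFun) p := by
  rcases eq_or_ne p q with rfl | h
  · exact (levelTangent_self p).le
  · rw [levelTangent_eq]; exact (level_tangent_lt hq hp h).le

lemma continuousOn_level : ContinuousOn (height ∘ bookFun) halfCylinder :=
  height_contDiff.continuous.comp_continuousOn continuousOn_bookFun

lemma isCompact_slab (n : ℝ) : IsCompact {p ∈ halfCylinder | -n - 1 ≤ p 2 ∧ p 2 ≤ -n} := by
  apply Metric.isCompact_of_isClosed_isBounded
  · have h : ∀ i : Fin 3, Continuous fun p : E3 => p i := fun i => by fun_prop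
    have c1 : IsClosed {p : E3 | p 0 ^ 2 + p 1 ^ 2 ≤ (1 / 4) ^ 2} :=
      isClosed_le (by fun_prop) continuous_const
    have c2 : IsClosed {p : E3 | p 2 ≤ -1} := isClosed_le (h 2) continuous_const
    have c3 : IsClosed {p : E3 | -n - 1 ≤ p 2} := isClosed_le continuous_const (h 2)
    have c4 : IsClosed {p : E3 | p 2 ≤ -n} := isClosed_le (h 2) continuous_const
    exact (c1.inter c2).inter (c3.inter c4)
  · refine isBounded_iff_forall_norm_le.2 ⟨2 * (|n| + 1), ?_⟩
    rintro p ⟨⟨h1, -⟩, h2, h3⟩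
    refine norm_le_of_coord_le fun i => ?_
    have h4 := neg_abs_le n
    have h5 := le_abs_self n
    fin_cases i
    · exact (abs_le_of_sq_le_sq (b := 1 / 4) (by simp; nlinarith [sq_nonneg (p 1)])
        (by norm_num)).trans (by linarith [abs_nonneg n])
    · exact (abs_le_of_sq_le_sq (b := 1 / 4) (by simp; nlinarith [sq_nonneg (p 0)])
        (by norm_num)).trans (by linarith [abs_nonneg n])
    · exact abs_le.2 ⟨by simp; linarith, by simp; linarith⟩

/-- Finitely many tangents approximate `height ∘ bookFun` on a slab. -/
lemma exists_tangent_net (n : ℕ) (hn : 1 ≤ n) :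
    ∃ A : Set E3, A.Finite ∧ (∀ p ∈ A, p ∈ halfCylinder ∧ p 2 ≤ -n) ∧
      ∀ p ∈ halfCylinder, -n - 1 ≤ p 2 → p 2 ≤ -n →
        ∃ q ∈ A, (height ∘ bookFun) p - levelTangent q p ≤ 1 / n := by
  have hn' : (0 : ℝ) < 1 / n := by positivity
  obtain ⟨t, ht, hcov⟩ := (isCompact_slab n).elim_nhdsWithin_subcover
    (fun q => {p | (height ∘ bookFun) p - levelTangent q p < 1 / n}) (fun q hq => by
      have hc : ContinuousWithinAt (fun p => (height ∘ bookFun) p - levelTangent q p)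
          {p ∈ halfCylinder | -(n : ℝ) - 1 ≤ p 2 ∧ p 2 ≤ -n} q := by
        refine ContinuousWithinAt.sub ((continuousOn_level q hq.1).mono fun p hp => hp.1) ?_
        unfold levelTangent
        exact Continuous.continuousWithinAt (by fun_prop)
      have := hc.tendsto
      rw [levelTangent_self, sub_self] at this
      exact this (Iio_mem_nhds hn'))
  refine ⟨t, t.finite_toSet, fun p hp => ⟨(ht p hp).1, (ht p hp).2.2⟩, fun p hp h1 h2 => ?_⟩
  obtain ⟨q, hq, hpq⟩ := Set.mem_iUnion₂.1 (hcov ⟨hp, h1, h2⟩)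
  exact ⟨q, hq, le_of_lt hpq⟩

end Nets

/-! ### The maximum of the tangents over a discrete set. -/

section TangentFamily

/-- The tangents at far points of the half-cylinder are very negative on a given ball. -/
lemma levelTangent_le_neg {q p : E3} {R : ℝ} (hq : q ∈ halfCylinder) (hp : ‖p‖ ≤ R)
    (hfar : 4 * R + 3 ≤ -q 2) : levelTangent q p ≤ 4 * R + 3 + q 2 := by
  have hR : 0 ≤ R := (norm_nonneg p).trans hp
  have hc : ∀ i, |p i| ≤ R := fun i => (PiLp.norm_apply_le p i).trans hp
  have hx : |q 0| ≤ 1 / 4 := abs_le_of_sq_le_sq (by nlinarith [hq.1, sq_nonneg (q 1)])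
    (by norm_num)
  have hy : |q 1| ≤ 1 / 4 := abs_le_of_sq_le_sq (by nlinarith [hq.1, sq_nonneg (q 0)])
    (by norm_num)
  obtain ⟨ha, -⟩ := bookFun_spec hq
  set a := bookFun q with had
  have hu : |p 0 - q 0| ≤ R + 1 / 4 := (abs_sub _ _).trans (add_le_add (hc 0) hx)
  have hv : |p 1 - q 1| ≤ R + 1 / 4 := (abs_sub _ _).trans (add_le_add (hc 1) hy)
  have h1 : |Real.tanh (a * spineDist (q 0) (q 1) a) * spineDist (p 0 - q 0) (p 1 - q 1) a|
      ≤ 2 * (R + 1 / 4) :=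
    abs_tanh_mul_le _ ((abs_spineDist_le_add _ _ _).trans (by linarith))
  have h2 : 2 * (q 0 * (p 0 - q 0) + q 1 * (p 1 - q 1)) / (1 + a) ≤ 1 / 2 * (R + 1 / 4) := by
    have g1 : q 0 * (p 0 - q 0) ≤ 1 / 4 * (R + 1 / 4) :=
      (le_abs_self _).trans ((abs_mul _ _).le.trans
        (mul_le_mul hx hu (abs_nonneg _) (by norm_num)))
    have g2 : q 1 * (p 1 - q 1) ≤ 1 / 4 * (R + 1 / 4) :=
      (le_abs_self _).trans ((abs_mul _ _).le.trans
        (mul_le_mul hy hv (abs_nonneg _) (by norm_num)))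
    rw [div_le_iff₀ (by linarith)]
    nlinarith
  have h3 : -q 2 - 4 * R - 2 ≤ bookSlope (q 0) (q 1) a (p 0 - q 0) (p 1 - q 1) (p 2 - q 2) := by
    have := (abs_le.1 (hc 2)).1
    have := (abs_le.1 h1).2
    unfold bookSlope
    linarith
  have h4 := levelSpeed_ge hq
  have h5 := one_le_height a
  rw [levelTangent_eq, levelGrad, inner_neg_left, inner_smul_left, inner_bookNormal]
  set m := bookSlope (q 0) (q 1) a ((p - q) 0) ((p - q) 1) ((p - q) 2) with hm
  have h6 : -q 2 - 4 * R - 2 ≤ m := h3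
  have h7 : height a ≤ levelSpeed q := by nlinarith
  have h8 : height a * m ≤ levelSpeed q * m := mul_le_mul_of_nonneg_right h7 (by linarith)
  -- The left side is at most `height a * (1 - m)`, hence at most `1 - m`, because `height a ≥ 1`
  -- and `m ≥ 1`.
  change height a + -(levelSpeed q * m) ≤ _
  nlinarith

variable {S : Set E3}

/-- The maximum of the tangents of `height ∘ bookFun` at the points of `S`. -/
noncomputable def tangentMax (S : Set E3) : E3 → ℝ :=
  maxAffine (fun q : S => levelGrad q)
    (fun q : S => (height ∘ bookFun) q - ⟪levelGrad (q : E3), (q : E3)⟫)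

/-- A set of tangent points in the half-cylinder, of which finitely many lie above any given
height. -/
structure IsTangentSet (S : Set E3) : Prop where
  nonempty : S.Nonempty
  subset : S ⊆ halfCylinder
  finite : ∀ m : ℝ, {q ∈ S | -m ≤ q 2}.Finite

namespace IsTangentSet

lemma locallyFew (h : IsTangentSet S) : LocallyFewAffine (fun q : S => levelGrad q)
    (fun q : S => (height ∘ bookFun) q - ⟪levelGrad (q : E3), (q : E3)⟫) := by
  intro R M
  refine ((h.finite (4 * |R| + 3 + |M|)).preimage Subtype.val_injective.injOn).subset ?_
  rintro ⟨q, hq⟩ ⟨p, hp, hM⟩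
  refine ⟨hq, ?_⟩
  by_contra hcon
  push Not at hcon
  have h1 : levelTangent q p ≤ _ := levelTangent_le_neg (R := |R|) (h.subset hq)
    (hp.trans (le_abs_self R)) (by linarith [abs_nonneg M])
  have h2 : M ≤ levelTangent q p := hM
  linarith [neg_abs_le M]

lemma levelTangent_le_tangentMax (h : IsTangentSet S) {q : E3} (hq : q ∈ S) (p : E3) :
    levelTangent q p ≤ tangentMax S p := by
  have : Nonempty S := h.nonempty.to_subtype
  exact h.locallyFew.le_maxAffine p ⟨q, hq⟩

lemma tangentMax_le (h : IsTangentSet S) {p : E3} (hp : p ∈ halfCylinder) :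
    tangentMax S p ≤ (height ∘ bookFun) p := by
  have : Nonempty S := h.nonempty.to_subtype
  exact maxAffine_le fun q => levelTangent_le (h.subset q.2) hp

/-- The tangent at `q` touches `height ∘ bookFun` there while all tangents stay below it, so it is
active at `q`. -/
lemma levelGrad_mem (h : IsTangentSet S) {q : E3} (hq : q ∈ S) :
    levelGrad q ∈ subdifferential (tangentMax S) q := by
  have : Nonempty S := h.nonempty.to_subtype
  refine h.locallyFew.mem_subdifferential (j := ⟨q, hq⟩) (le_antisymm ?_
    (h.locallyFew.le_maxAffine q ⟨q, hq⟩))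
  refine (h.tangentMax_le (h.subset hq)).trans ?_
  exact (levelTangent_self q).ge

lemma neg_levelGrad_mem (h : IsTangentSet S) {q : E3} (hq : q ∈ S) :
    -levelGrad q ∈ subgradientField (tangentMax S) q := by
  change - -levelGrad q ∈ subdifferential (tangentMax S) q
  rw [neg_neg]
  exact h.levelGrad_mem hq

/-- A tangent active at an axis point is active together with its half turn; the mean of the two
gradients is a vertical subgradient. -/
lemma exists_axis_trajectory (h : IsTangentSet S) (hsymm : ∀ q ∈ S, halfTurn q ∈ S) (z : ℝ) :
    ∃ x, IsUnperturbedTrajectory (subgradientField (tangentMax S)) x ∧ x 0 = axisPoint z ∧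
      ∀ t, 0 ≤ t → ∃ z', x t = axisPoint z' := by
  have : Nonempty S := h.nonempty.to_subtype
  refine h.locallyFew.exists_axis_trajectory (fun q => ?_) ?_ (fun m => ?_) z
  · rw [levelGrad_two]
    linarith [levelSpeed_pos (h.subset q.2)]
  · rintro ⟨q, hq⟩ z hz y
    have hqΩ := h.subset hq
    have hz : tangentMax S (axisPoint z) = levelTangent q (axisPoint z) := hz
    change tangentMax S (axisPoint z) + ⟪-axisPoint (-levelGrad q 2), y - axisPoint z⟫
      ≤ tangentMax S y
    have h1 := h.levelTangent_le_tangentMax hq y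
    have h2 := h.levelTangent_le_tangentMax (hsymm q hq) y
    have h3 : levelTangent (halfTurn q) y = levelTangent q (halfTurn y) := by
      unfold levelTangent
      rw [levelGrad_halfTurn hqΩ, inner_halfTurn, Function.comp_apply, bookFun_halfTurn hqΩ,
        ← inner_halfTurn (levelGrad q) (halfTurn y), halfTurn_halfTurn]
      rfl
    have h4 : ⟪-axisPoint (-levelGrad q 2), y - axisPoint z⟫
        = 1 / 2 * ⟪levelGrad q, y⟫ + 1 / 2 * ⟪levelGrad q, halfTurn y⟫
          - ⟪levelGrad q, axisPoint z⟫ := by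
      simp only [inner_e3, axisPoint, halfTurn]
      simp
      ring
    rw [hz, h4]
    rw [h3] at h2
    unfold levelTangent at *
    linarith
  · refine ((h.finite (-m)).preimage Subtype.val_injective.injOn).subset ?_
    rintro ⟨q, hq⟩ hm
    refine ⟨hq, ?_⟩
    have hm : m < levelGrad q 2 := hm
    rw [levelGrad_two] at hm
    linarith [neg_coord_le_levelSpeed (h.subset hq)]

lemma not_finitely (h : IsTangentSet S) (hdeep : ∀ n : ℕ, ∃ q ∈ S, q 2 ≤ -n) :
    ¬ IsFinitelyPiecewiseLinearConvex (tangentMax S) := by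
  intro hfin
  obtain ⟨C, hC⟩ := hfin.exists_norm_le
  obtain ⟨n, hn⟩ := exists_nat_gt C
  obtain ⟨q, hq, hqn⟩ := hdeep n
  have h1 := hC q _ (h.levelGrad_mem hq)
  have h2 := (neg_le_abs _).trans (PiLp.norm_apply_le (levelGrad q) 2)
  rw [levelGrad_two, neg_neg] at h2
  linarith [neg_coord_le_levelSpeed (h.subset hq)]

end IsTangentSet

end TangentFamily

/-! ### Choice of the tangent points and conclusion. -/

/-- There is a symmetric set of tangent points that contains, for each `n ≥ 1`, a net of a slab
and the points of a control sequence. -/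
lemma exists_tangentSet : ∃ S : Set E3, IsTangentSet S ∧ (∀ q ∈ S, halfTurn q ∈ S) ∧
    (∀ n : ℕ, ∃ q ∈ S, q 2 ≤ -n) ∧
    (∀ n : ℕ, 1 ≤ n → ∀ p ∈ halfCylinder, -n - 1 ≤ p 2 → p 2 ≤ -n →
        ∃ q ∈ S, (height ∘ bookFun) p - levelTangent q p ≤ 1 / n) ∧
    ∀ N : ℕ, 1 ≤ N → ∃ (K : ℕ) (p w : ℕ → E3) (d : ℕ → ℝ) (ε z : ℝ), 0 < ε ∧
      p 0 = axisPoint z ∧ w 0 = axisPoint z ∧ (∀ k ≤ K, p k ∈ S) ∧ (∀ k < K, 0 < d k) ∧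
      (∀ k < K, w (k + 1) = w k + d k • -levelGrad (p k)) ∧ (∀ k ≤ K, ‖p k - w k‖ ≤ ε) ∧
      (∀ k < K, ‖p k - w (k + 1)‖ ≤ ε) ∧ ∀ z', N * ε < ‖p K - axisPoint z'‖ := by
  choose! A hAfin hA hnet using exists_tangent_net
  choose! K p w d ε z hε hp0 hw0 hp hd hw hpw hpw' hfar using exists_control_sequence
  -- Shifted by one because nets and control sequences exist for `n ≥ 1`. Each `G n` is finite and
  -- lies below `-(n + 1)`, so finitely many points are above any height.
  set G : ℕ → Set E3 := fun n => A (n + 1) ∪ p (n + 1) '' Set.Iic (K (n + 1)) with hG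
  have hGfin : ∀ n, (G n).Finite := fun n =>
    (hAfin _ (by omega)).union ((Set.finite_Iic _).image _)
  have hGmem : ∀ n, ∀ q ∈ G n, q ∈ halfCylinder ∧ q 2 ≤ -((n + 1 : ℕ) : ℝ) := by
    rintro n q (hq | ⟨k, hk, rfl⟩)
    · exact hA _ (by omega) q hq
    · exact hp _ (by omega) k hk
  have htwo : ∀ q, halfTurn q 2 = q 2 := fun q => by simp [halfTurn]
  set S : Set E3 := {q | ∃ n, q ∈ G n ∨ halfTurn q ∈ G n} with hS
  have hmem : ∀ n, ∀ q, q ∈ G n ∨ halfTurn q ∈ G n →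
      q ∈ halfCylinder ∧ q 2 ≤ -((n + 1 : ℕ) : ℝ) := by
    rintro n q (hq | hq)
    · exact hGmem n q hq
    · have h1 := hGmem n _ hq
      rw [htwo] at h1
      refine ⟨?_, h1.2⟩
      rw [← halfTurn_halfTurn q]
      exact halfTurn_mem h1.1
  have hpS : ∀ N, 1 ≤ N → ∀ k ≤ K N, p N k ∈ S := by
    intro N hN k hk
    refine ⟨N - 1, Or.inl (Or.inr ?_)⟩
    rw [Nat.sub_add_cancel hN]
    exact ⟨k, hk, rfl⟩
  refine ⟨S, ⟨⟨_, hpS 1 le_rfl 0 (Nat.zero_le _)⟩, ?_, ?_⟩, ?_, ?_, ?_, ?_⟩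
  · rintro q ⟨n, hq⟩
    exact (hmem n q hq).1
  · intro m
    have hinj : Function.Injective halfTurn := fun p q hpq => by
      rw [← halfTurn_halfTurn p, hpq, halfTurn_halfTurn]
    refine ((Set.finite_Iic ⌈m⌉₊).biUnion fun n _ =>
      (hGfin n).union ((hGfin n).preimage hinj.injOn)).subset ?_
    rintro q ⟨⟨n, hq⟩, hqm⟩
    refine Set.mem_biUnion (x := n) ?_ hq
    have h1 := (hmem n q hq).2
    push_cast at h1
    have h2 : (n : ℝ) ≤ ⌈m⌉₊ := by linarith [Nat.le_ceil m]
    exact_mod_cast h2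
  · rintro q ⟨n, hq⟩
    refine ⟨n, ?_⟩
    rw [halfTurn_halfTurn]
    exact hq.symm
  · intro n
    have h1 := (hp (n + 1) (by omega) 0 (Nat.zero_le _)).2
    push_cast at h1
    exact ⟨_, hpS (n + 1) (by omega) 0 (Nat.zero_le _), by linarith⟩
  · intro n hn q hq h1 h2
    obtain ⟨q', hq', h3⟩ := hnet n hn q hq h1 h2
    refine ⟨q', ⟨n - 1, Or.inl (Or.inl ?_)⟩, h3⟩
    rwa [Nat.sub_add_cancel hn]
  · intro N hN
    exact ⟨K N, p N, w N, d N, ε N, z N, hε N hN, hp0 N hN, hw0 N hN, hpS N hN, hd N hN, hw N hN,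
      hpw N hN, hpw' N hN, hfar N hN⟩

theorem mainTheorem2 :
    ∃ (f : E3 → ℝ) (h : ℝ → ℝ) (Ψ : E3 → ℝ),
      IsBookFunction f ∧
      StrictMono h ∧ ContDiff ℝ 2 h ∧ StrictConvexOn ℝ halfCylinder (h ∘ f) ∧
      ConvexOn ℝ Set.univ Ψ ∧ IsPiecewiseLinear Ψ ∧ ¬ IsFinitelyPiecewiseLinearConvex Ψ ∧
      ApproximatesDownward Ψ (h ∘ f) ∧
      ¬ HasBoundedSensitivity (subgradientField Ψ) := by
  obtain ⟨S, hS, hsymm, hdeep, hnet, hctrl⟩ := exists_tangentSet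
  have : Nonempty S := hS.nonempty.to_subtype
  refine ⟨bookFun, height, tangentMax S, isBookFunction_bookFun, height_strictMono,
    height_contDiff, strictConvexOn_level, hS.locallyFew.convexOn,
    hS.locallyFew.isPiecewiseLinear, hS.not_finitely hdeep, ?_, ?_⟩
  · intro ε hε
    obtain ⟨m, hm⟩ := exists_nat_gt (1 / ε)
    refine ⟨-(m + 1), fun p hp hz => ?_⟩
    have hm0 : (0 : ℝ) ≤ m := m.cast_nonneg
    -- The slab containing `p`; its net has error at most `1 / n ≤ ε`.
    set n := ⌊-p 2⌋₊ with hn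
    have h0 : 0 ≤ -p 2 := by linarith
    have h1 : (n : ℝ) ≤ -p 2 := Nat.floor_le h0
    have h2 : -p 2 < n + 1 := Nat.lt_floor_add_one _
    have h3 : (m : ℝ) < n := by
      have : m + 1 ≤ n := Nat.le_floor (by push_cast; linarith)
      exact_mod_cast this
    obtain ⟨q, hq, hqp⟩ := hnet n (by
      have : (0 : ℝ) < n := by linarith
      exact_mod_cast this) p hp (by linarith) (by linarith)
    have h4 := hS.levelTangent_le_tangentMax hq p
    have h5 := hS.tangentMax_le hp
    have h6 : 1 / (n : ℝ) ≤ ε := by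
      rw [one_div_le (by linarith) hε]
      linarith
    rw [abs_of_nonpos (by linarith)]
    linarith
  · rintro ⟨C, hC⟩
    obtain ⟨N, hN⟩ := exists_nat_gt (C : ℝ)
    have hN1 : 1 ≤ N := by
      have : (0 : ℝ) < N := C.coe_nonneg.trans_lt hN
      exact_mod_cast this
    obtain ⟨K, p, w, d, ε, z, hε, hp0, hw0, hpS, hd, hw, hpw, hpw', hfar⟩ := hctrl N hN1
    obtain ⟨y, U, T, hT, hy, hy0, hyT, hU⟩ := exists_jumping_trajectory
      (F := subgradientField (tangentMax S)) K p (fun k => -levelGrad (p k)) w d hd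
      (fun k hk => hS.neg_levelGrad_mem (hpS k hk)) hw hpw hpw'
    obtain ⟨x, hx, hx0, hxa⟩ := hS.exists_axis_trajectory hsymm z
    -- Where on the axis the unperturbed trajectory is at time `T` does not matter: `p K` is far
    -- from every axis point.
    obtain ⟨z', hz'⟩ := hxa T hT
    have h1 := hC x U y hx hy (by rw [hy0, hx0, hp0]) T hT
    have h2 : ⨆ τ ∈ Set.Icc 0 T, ‖U τ‖ₑ ≤ ENNReal.ofReal ε := by
      refine iSup₂_le fun τ hτ => ?_
      have := hU τ hτ
      rw [hp0, hw0, sub_self, add_zero] at this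
      rw [← ofReal_norm]
      exact ENNReal.ofReal_le_ofReal this
    have h3 := h1.trans (mul_le_mul_right h2 (C : ℝ≥0∞))
    rw [hyT, hz', edist_dist, dist_eq_norm, ← ENNReal.ofReal_coe_nnreal,
      ← ENNReal.ofReal_mul C.coe_nonneg, ENNReal.ofReal_le_ofReal_iff (by positivity)] at h3
    have h4 := hfar z'
    have := mul_lt_mul_of_pos_right hN hε
    linarith
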